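/- Let $d\ge 1$. A dyadic cube in $\mathbb{R}^d$ is a set $2^{-k}([0,1)^d+j)$ with $k\in\mathbb{Z}$, $j\in\mathbb{Z}^d$. For a Banach lattice $E$, a non-empty finite collection $\mathcal{D}$ of dyadic cubes and $f\in L^p_E(\mathbb{R}^d,dx)$ put $\bar M_{\mathcal{D}}f:=\sup_{Q\in\mathcal{D}}\langle f\rangle_Q 1_Q$, where $\langle f\rangle_Q:=|Q|^{-1}\int_Q f\,dx$ and the supremum is taken in the order of $E$. The lattice $E$ has the (dyadic) Hardy--Littlewood property if for some $p\in(1,\infty)$ there is a finite constant $K$ such that $\|\bar M_{\mathcal{D}}f\|_{L^p_E}\le K\|f\|_{L^p_E}$ for all $f\in L^p_E$ and all such $\mathcal{D}$. Let $C$ and $D$ be real Banach lattices such that $C$ and $D^*$ each have the Hardy--Littlewood property; here $D^*$ is the dual Banach lattice of $D$, ordered by $\varphi\le\psi$ iff $\varphi(x)\le\psi(x)$ for all $x\ge0$. For a locally finite Borel measure $\mu$ on $\mathbb{R}^d$, a finite collection $\mathcal{D}$ of dyadic cubes and positive linear operators $\lambda_Q:C\to D$ ($Q\in\mathcal{D}$),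 let $$T_{\lambda,\mathcal{D}}(f\mu):=\sum_{Q\in\mathcal{D}}\lambda_Q\Big(\int_Q f\,d\mu\Big)1_Q .$$ (i) Let $\mu$ be a locally finite Borel measure, $\mathcal{S}$ a finite or infinite collection of dyadic cubes and $\lambda_Q:C\to D$ ($Q\in\mathcal{S}$) positive linear operators. Say that $T_\lambda(\,\cdot\,\mu)$ is bounded from $L^p_C(\mu)$ to $L^p_D(\mu)$ if the operators $T_{\lambda,\mathcal{D}}(\,\cdot\,\mu):L^p_C(\mu)\to L^p_D(\mu)$ are bounded uniformly over all finite $\mathcal{D}\subseteq\mathcal{S}$. Then $T_\lambda(\,\cdot\,\mu):L^p_C(\mu)\to L^p_D(\mu)$ is bounded for some $p\in(1,\infty)$ if and only if it is bounded for every $p\in(1,\infty)$. (ii) Quantitatively, for every $q\in(1,\infty)$ there is a finite constant $K$, depending only on $q$, $d$, $C$ and $D$, such that $$\|T_{\lambda,\mathcal{D}}(\,\cdot\,\mu)\|_{L^q_C(\mu)\to L^q_D(\mu)}\le K\,\|T_{\lambda,\mathcal{D}}(\,\cdot\,\mu)\|_{L^p_C(\mu)\to L^p_D(\mu)}$$ for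 every $p\in(1,\infty)$, every locally finite Borel measure $\mu$ on $\mathbb{R}^d$, every finite collection $\mathcal{D}$ of dyadic cubes and all positive linear operators $\lambda_Q:C\to D$, $Q\in\mathcal{D}$. -/

import Mathlib

open MeasureTheory
open scoped ENNReal NNReal

/-! ### The dual of a Banach lattice

Throughout, a (real) Banach lattice `E` is given by Mathlib's classes
`[NormedAddCommGroup E] [NormedSpace ℝ E] [CompleteSpace E] [Lattice E] [HasSolidNorm E]
[IsOrderedAddMonoid E] [IsOrderedModule ℝ E]`. -/

/-- The space of continuous linear functionals on `E` with the operator norm.  (A type synonym, so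
that the order of the dual of a Banach lattice cannot be confused with any other order that
`E →L[ℝ] ℝ` may carry, such as the Loewner order on `ℝ →L[ℝ] ℝ`.) -/
def LatticeDual (E : Type*) [NormedAddCommGroup E] [NormedSpace ℝ E] : Type _ := E →L[ℝ] ℝ

namespace LatticeDual

section Normed

variable {E : Type*} [NormedAddCommGroup E] [NormedSpace ℝ E]

noncomputable instance : NormedAddCommGroup (LatticeDual E) :=
  inferInstanceAs (NormedAddCommGroup (E →L[ℝ] ℝ))

noncomputable instance : NormedSpace ℝ (LatticeDual E) :=
  inferInstanceAs (NormedSpace ℝ (E →L[ℝ] ℝ))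

instance : CompleteSpace (LatticeDual E) :=
  inferInstanceAs (CompleteSpace (E →L[ℝ] ℝ))

/-- The underlying continuous linear functional. -/
def toCLM (φ : LatticeDual E) : E →L[ℝ] ℝ := φ

/-- A continuous linear functional as an element of the dual. -/
def ofCLM (φ : E →L[ℝ] ℝ) : LatticeDual E := φ

instance : CoeFun (LatticeDual E) (fun _ => E → ℝ) := ⟨fun φ x => toCLM φ x⟩

theorem add_apply (φ ψ : LatticeDual E) (x : E) : (φ + ψ) x = φ x + ψ x := rfl
theorem sub_apply (φ ψ : LatticeDual E) (x : E) : (φ - ψ) x = φ x - ψ x := rfl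
theorem neg_apply (φ : LatticeDual E) (x : E) : (-φ) x = -φ x := rfl
theorem smul_apply (r : ℝ) (φ : LatticeDual E) (x : E) : (r • φ) x = r * φ x := rfl
theorem abs_apply_le (φ : LatticeDual E) (x : E) : |φ x| ≤ ‖φ‖ * ‖x‖ :=
  (toCLM φ).le_opNorm x

end Normed

section Order

variable {E : Type*} [NormedAddCommGroup E] [NormedSpace ℝ E] [Lattice E] [HasSolidNorm E]
  [IsOrderedAddMonoid E]

/-- The order of the dual: `φ ≤ ψ` if and only if `φ x ≤ ψ x` for all `x ≥ 0`. -/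
instance : PartialOrder (LatticeDual E) where
  le φ ψ := ∀ x : E, 0 ≤ x → φ x ≤ ψ x
  le_refl φ x _ := le_refl _
  le_trans φ ψ χ h₁ h₂ x hx := (h₁ x hx).trans (h₂ x hx)
  le_antisymm φ ψ h₁ h₂ := by
    refine ContinuousLinearMap.ext fun x => ?_
    have key : ∀ y : E, 0 ≤ y → toCLM φ y = toCLM ψ y :=
      fun y hy => le_antisymm (h₁ y hy) (h₂ y hy)
    have hx : x⁺ - x⁻ = x := posPart_sub_negPart x
    change toCLM φ x = toCLM ψ x
    rw [← hx, map_sub, map_sub, key _ (posPart_nonneg x), key _ (negPart_nonneg x)]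

theorem le_iff (φ ψ : LatticeDual E) : φ ≤ ψ ↔ ∀ x : E, 0 ≤ x → φ x ≤ ψ x := Iff.rfl

instance : IsOrderedAddMonoid (LatticeDual E) where
  add_le_add_left φ ψ h χ x hx := by
    simpa [add_apply] using h x hx

instance : IsOrderedModule ℝ (LatticeDual E) where
  smul_le_smul_of_nonneg_left r hr φ ψ h x hx := by
    simpa [smul_apply] using mul_le_mul_of_nonneg_left (h x hx) hr
  smul_le_smul_of_nonneg_right φ hφ r s hrs x hx := by
    have h0 : 0 ≤ φ x := hφ x hx
    simpa [smul_apply] using mul_le_mul_of_nonneg_right hrs h0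

/-- The positive part of a functional on the positive cone: `sup {φ d : 0 ≤ d ≤ x}`. -/
noncomputable def coneSup (φ : LatticeDual E) (x : E) : ℝ :=
  sSup ((fun d => φ d) '' Set.Icc 0 x)

theorem norm_le_of_nonneg_of_le {d x : E} (h0 : 0 ≤ d) (h : d ≤ x) : ‖d‖ ≤ ‖x‖ :=
  norm_le_norm_of_abs_le_abs (by rwa [abs_of_nonneg h0, abs_of_nonneg (h0.trans h)])

theorem apply_le_norm (φ : LatticeDual E) {d x : E} (h0 : 0 ≤ d) (h : d ≤ x) :
    φ d ≤ ‖φ‖ * ‖x‖ :=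
  (le_abs_self _).trans ((abs_apply_le φ d).trans
    (mul_le_mul_of_nonneg_left (norm_le_of_nonneg_of_le h0 h) (norm_nonneg φ)))

theorem le_coneSup (φ : LatticeDual E) {d x : E} (h0 : 0 ≤ d) (h : d ≤ x) :
    φ d ≤ coneSup φ x := by
  refine le_csSup ⟨‖φ‖ * ‖x‖, ?_⟩ ⟨d, ⟨h0, h⟩, rfl⟩
  rintro _ ⟨e, ⟨he0, he⟩, rfl⟩
  exact apply_le_norm φ he0 he

theorem coneSup_le (φ : LatticeDual E) {x : E} (hx : 0 ≤ x) {a : ℝ}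
    (h : ∀ d, 0 ≤ d → d ≤ x → φ d ≤ a) : coneSup φ x ≤ a := by
  refine csSup_le ⟨φ 0, 0, ⟨le_rfl, hx⟩, rfl⟩ ?_
  rintro _ ⟨e, ⟨he0, he⟩, rfl⟩
  exact h e he0 he

theorem coneSup_nonneg (φ : LatticeDual E) {x : E} (hx : 0 ≤ x) : 0 ≤ coneSup φ x := by
  have h := le_coneSup φ le_rfl hx
  rwa [show φ (0 : E) = 0 from map_zero (toCLM φ)] at h

theorem coneSup_add (φ : LatticeDual E) {x y : E} (hx : 0 ≤ x) (hy : 0 ≤ y) :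
    coneSup φ (x + y) = coneSup φ x + coneSup φ y := by
  apply le_antisymm
  · refine coneSup_le φ (add_nonneg hx hy) fun d hd0 hd => ?_
    have h1 : φ (d ⊓ x) ≤ coneSup φ x := le_coneSup φ (le_inf hd0 hx) inf_le_right
    have h2 : φ (d - d ⊓ x) ≤ coneSup φ y := by
      refine le_coneSup φ (sub_nonneg.2 inf_le_left) ?_
      rw [sub_le_comm]
      exact le_inf (sub_le_self d hy) (sub_le_iff_le_add.2 hd)
    have h3 : φ (d - d ⊓ x) = φ d - φ (d ⊓ x) := map_sub (toCLM φ) _ _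
    linarith
  · rw [← le_sub_iff_add_le]
    refine coneSup_le φ hx fun a ha0 ha => ?_
    rw [le_sub_iff_add_le, add_comm, ← le_sub_iff_add_le]
    refine coneSup_le φ hy fun b hb0 hb => ?_
    have h1 := le_coneSup φ (add_nonneg ha0 hb0) (add_le_add ha hb)
    have h2 : φ (a + b) = φ a + φ b := map_add (toCLM φ) _ _
    linarith

/-- The additive extension of `coneSup φ` from the positive cone to the whole space. -/
noncomputable def posAddHom (φ : LatticeDual E) : E →+ ℝ :=
  AddMonoidHom.mk' (fun x => coneSup φ x⁺ - coneSup φ x⁻) (by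
    intro x y
    have h : (x + y)⁺ + (x⁻ + y⁻) = (x + y)⁻ + (x⁺ + y⁺) := by
      have h1 := posPart_sub_negPart (x + y)
      have h2 := posPart_sub_negPart x
      have h3 := posPart_sub_negPart y
      have h4 : (x + y)⁺ - (x + y)⁻ = (x⁺ - x⁻) + (y⁺ - y⁻) := by rw [h1, h2, h3]
      rw [sub_eq_iff_eq_add] at h4
      rw [h4]; abel
    have h' := congrArg (coneSup φ) h
    rw [coneSup_add φ (posPart_nonneg _) (add_nonneg (negPart_nonneg _) (negPart_nonneg _)),
      coneSup_add φ (negPart_nonneg _) (negPart_nonneg _),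
      coneSup_add φ (negPart_nonneg _) (add_nonneg (posPart_nonneg _) (posPart_nonneg _)),
      coneSup_add φ (posPart_nonneg _) (posPart_nonneg _)] at h'
    linarith)

theorem abs_posAddHom_le (φ : LatticeDual E) (x : E) : ‖posAddHom φ x‖ ≤ ‖φ‖ * ‖x‖ := by
  have hp : ‖x⁺‖ ≤ ‖x‖ := norm_le_norm_of_abs_le_abs (by
    rw [abs_of_nonneg (posPart_nonneg x), ← posPart_add_negPart x]
    exact le_add_of_nonneg_right (negPart_nonneg x))
  have hn : ‖x⁻‖ ≤ ‖x‖ := norm_le_norm_of_abs_le_abs (by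
    rw [abs_of_nonneg (negPart_nonneg x), ← posPart_add_negPart x]
    exact le_add_of_nonneg_left (posPart_nonneg x))
  have b : ∀ y : E, 0 ≤ y → ‖y‖ ≤ ‖x‖ → coneSup φ y ≤ ‖φ‖ * ‖x‖ := fun y hy hyx =>
    coneSup_le φ hy fun d hd0 hd => (apply_le_norm φ hd0 hd).trans
      (mul_le_mul_of_nonneg_left hyx (norm_nonneg φ))
  have h1 := b _ (posPart_nonneg x) hp
  have h2 := b _ (negPart_nonneg x) hn
  have h3 := coneSup_nonneg φ (posPart_nonneg x)
  have h4 := coneSup_nonneg φ (negPart_nonneg x)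
  change |coneSup φ x⁺ - coneSup φ x⁻| ≤ _
  rw [abs_le]
  constructor <;> linarith

/-- The positive part of a continuous linear functional; on `x ≥ 0` its value is
`sup {φ d : 0 ≤ d ≤ x}`. -/
noncomputable def posFunctional (φ : LatticeDual E) : LatticeDual E :=
  ofCLM ((posAddHom φ).toRealLinearMap
    (AddMonoidHomClass.continuous_of_bound (posAddHom φ) ‖φ‖ (abs_posAddHom_le φ)))

theorem posFunctional_apply (φ : LatticeDual E) {x : E} (hx : 0 ≤ x) :
    posFunctional φ x = coneSup φ x := by
  change coneSup φ x⁺ - coneSup φ x⁻ = coneSup φ x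
  have h0 : coneSup φ (0 : E) = 0 := by
    have h := coneSup_add φ (le_refl (0 : E)) le_rfl
    rw [add_zero] at h
    linarith
  rw [posPart_of_nonneg hx, negPart_of_nonneg hx, h0, sub_zero]

/-- The dual is a lattice: `φ ⊔ ψ = φ + (ψ - φ)⁺`, that is,
`(φ ⊔ ψ) x = sup {φ (x - d) + ψ d : 0 ≤ d ≤ x}` for `x ≥ 0`, and `φ ⊓ ψ = φ - (φ - ψ)⁺`. -/
noncomputable instance : Lattice (LatticeDual E) where
  sup φ ψ := φ + posFunctional (ψ - φ)
  inf φ ψ := φ - posFunctional (φ - ψ)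
  le_sup_left φ ψ x hx := by
    rw [add_apply, posFunctional_apply _ hx]
    linarith [coneSup_nonneg (ψ - φ) hx]
  le_sup_right φ ψ x hx := by
    rw [add_apply, posFunctional_apply _ hx]
    have h := le_coneSup (ψ - φ) hx le_rfl
    rw [sub_apply] at h
    linarith
  sup_le φ ψ χ h₁ h₂ x hx := by
    rw [add_apply, posFunctional_apply _ hx]
    have h : coneSup (ψ - φ) x ≤ χ x - φ x := coneSup_le _ hx fun d hd0 hd => by
      have e1 := h₁ (x - d) (sub_nonneg.2 hd)
      have e2 := h₂ d hd0
      have e3 : φ (x - d) = φ x - φ d := map_sub (toCLM φ) _ _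
      have e4 : χ (x - d) = χ x - χ d := map_sub (toCLM χ) _ _
      rw [sub_apply]
      linarith
    linarith
  inf_le_left φ ψ x hx := by
    rw [sub_apply, posFunctional_apply _ hx]
    linarith [coneSup_nonneg (φ - ψ) hx]
  inf_le_right φ ψ x hx := by
    rw [sub_apply, posFunctional_apply _ hx]
    have h := le_coneSup (φ - ψ) hx le_rfl
    rw [sub_apply] at h
    linarith
  le_inf φ ψ χ h₁ h₂ x hx := by
    rw [sub_apply, posFunctional_apply _ hx]
    have h : coneSup (ψ - χ) x ≤ ψ x - φ x := coneSup_le _ hx fun d hd0 hd => by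
      have e1 := h₁ (x - d) (sub_nonneg.2 hd)
      have e2 := h₂ d hd0
      have e3 : φ (x - d) = φ x - φ d := map_sub (toCLM φ) _ _
      have e4 : ψ (x - d) = ψ x - ψ d := map_sub (toCLM ψ) _ _
      rw [sub_apply]
      linarith
    linarith

theorem sup_apply (φ ψ : LatticeDual E) {x : E} (hx : 0 ≤ x) :
    (φ ⊔ ψ) x = φ x + coneSup (ψ - φ) x := by
  change φ x + posFunctional (ψ - φ) x = _
  rw [posFunctional_apply _ hx]

/-- The operator norm is a lattice norm, so the dual is again a Banach lattice. -/
instance : HasSolidNorm (LatticeDual E) where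
  solid φ ψ h := by
    refine ContinuousLinearMap.opNorm_le_bound _ (norm_nonneg ψ) fun x => ?_
    change |φ x| ≤ ‖ψ‖ * ‖x‖
    have h1 : |φ x| ≤ |φ| |x| := by
      have a1 : φ ≤ |φ| := le_abs_self φ
      have a2 : -φ ≤ |φ| := neg_le_abs φ
      have e1 := a1 _ (posPart_nonneg x)
      have e2 := a1 _ (negPart_nonneg x)
      have e3 := a2 _ (posPart_nonneg x)
      have e4 := a2 _ (negPart_nonneg x)
      rw [neg_apply] at e3 e4
      have hx : φ x = φ x⁺ - φ x⁻ := by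
        conv_lhs => rw [← posPart_sub_negPart x]
        exact map_sub (toCLM φ) _ _
      have hx' : |φ| |x| = |φ| x⁺ + |φ| x⁻ := by
        conv_lhs => rw [← posPart_add_negPart x]
        exact map_add (toCLM |φ|) _ _
      rw [hx, hx', abs_le]
      constructor <;> linarith
    have h2 : |φ| |x| ≤ |ψ| |x| := h _ (abs_nonneg x)
    have h3 : |ψ| |x| ≤ ‖ψ‖ * ‖x‖ := by
      have e : |ψ| |x| = ψ |x| + coneSup (-ψ - ψ) |x| := sup_apply ψ (-ψ) (abs_nonneg x)
      rw [e, add_comm, ← le_sub_iff_add_le]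
      refine coneSup_le _ (abs_nonneg x) fun d hd0 hd => ?_
      have f1 : ψ (|x| - d - d) = ψ |x| - ψ d - ψ d := by
        rw [show ψ (|x| - d - d) = ψ (|x| - d) - ψ d from map_sub (toCLM ψ) _ _,
          show ψ (|x| - d) = ψ |x| - ψ d from map_sub (toCLM ψ) _ _]
      have f2 : ‖|x| - d - d‖ ≤ ‖x‖ := norm_le_norm_of_abs_le_abs (by
        refine abs_le'.2 ⟨?_, ?_⟩
        · exact (sub_le_self _ hd0).trans (sub_le_self _ hd0)
        · have : -(|x| - d - d) = d - (|x| - d) := by abel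
          rw [this]
          exact (sub_le_self _ (sub_nonneg.2 hd)).trans hd)
      have f3 := (le_abs_self _).trans ((abs_apply_le ψ (|x| - d - d)).trans
        (mul_le_mul_of_nonneg_left f2 (norm_nonneg ψ)))
      rw [f1] at f3
      rw [sub_apply, neg_apply]
      linarith
    exact h1.trans (h2.trans h3)

end Order

end LatticeDual

/-! ### Dyadic cubes, the lattice maximal operator and the positive dyadic operator

The space `ℝ^d` is modelled by `Fin d → ℝ`; it has the topology, the Borel sets and the Lebesgue
measure `volume` of the Euclidean space. -/

/-- A dyadic cube `2^{-k} ([0,1)^d + j)` in `ℝ^d`, given by `k ∈ ℤ` and `j ∈ ℤ^d`. -/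
@[ext] structure DyadicCube (d : ℕ) where
  /-- The generation: the side length is `2^{-k}`. -/
  k : ℤ
  /-- The position. -/
  j : Fin d → ℤ

/-- The dyadic cube as a set of points. -/
def DyadicCube.toSet {d : ℕ} (Q : DyadicCube d) : Set (Fin d → ℝ) :=
  {x | ∀ i, (2 : ℝ) ^ (-Q.k) * (Q.j i : ℝ) ≤ x i ∧ x i < (2 : ℝ) ^ (-Q.k) * ((Q.j i : ℝ) + 1)}

/-- The dyadic lattice Hardy--Littlewood maximal function `sup_{Q ∈ 𝒟} ⟨f⟩_Q 1_Q` of a non-empty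
finite collection `𝒟`, where `⟨f⟩_Q` is the average with respect to the Lebesgue measure and the
supremum is taken in the lattice `E`. -/
noncomputable def latticeMaximal {d : ℕ} {E : Type*} [NormedAddCommGroup E] [NormedSpace ℝ E]
    [Lattice E] (𝒟 : Finset (DyadicCube d)) (h𝒟 : 𝒟.Nonempty) (f : (Fin d → ℝ) → E)
    (x : Fin d → ℝ) : E :=
  𝒟.sup' h𝒟 fun Q => Q.toSet.indicator (fun _ => ⨍ y in Q.toSet, f y) x

/-- The dyadic Hardy--Littlewood property (with respect to dyadic cubes in `ℝ^d`): for some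
`p ∈ (1,∞)` the dyadic lattice maximal operators are bounded on `L^p_E`, uniformly over the finite
collections of dyadic cubes. -/
def HasHardyLittlewoodProperty (d : ℕ) (E : Type*) [NormedAddCommGroup E] [NormedSpace ℝ E]
    [Lattice E] : Prop :=
  ∃ p : ℝ≥0∞, 1 < p ∧ p < ∞ ∧ ∃ K : ℝ≥0,
    ∀ (𝒟 : Finset (DyadicCube d)) (h𝒟 : 𝒟.Nonempty) (f : (Fin d → ℝ) → E),
      MemLp f p volume →
        eLpNorm (latticeMaximal 𝒟 h𝒟 f) p volume ≤ K * eLpNorm f p volume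

/-- The operator `T_λ(f μ) = ∑_{Q ∈ 𝒟} λ_Q (∫_Q f dμ) 1_Q`. -/
noncomputable def dyadicOperator {d : ℕ} {C D : Type*} [NormedAddCommGroup C] [NormedSpace ℝ C]
    [NormedAddCommGroup D] [NormedSpace ℝ D] (𝒟 : Finset (DyadicCube d))
    (l : DyadicCube d → C →ₗ[ℝ] D) (μ : Measure (Fin d → ℝ)) (f : (Fin d → ℝ) → C)
    (x : Fin d → ℝ) : D :=
  ∑ Q ∈ 𝒟, Q.toSet.indicator (fun _ => l Q (∫ y in Q.toSet, f y ∂μ)) x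

/-- `T_λ(· μ) : L^p_C(μ) → L^p_D(μ)` is bounded with norm at most `A`. -/
def DyadicOperatorBound {d : ℕ} {C D : Type*} [NormedAddCommGroup C] [NormedSpace ℝ C]
    [NormedAddCommGroup D] [NormedSpace ℝ D] (𝒟 : Finset (DyadicCube d))
    (l : DyadicCube d → C →ₗ[ℝ] D) (μ : Measure (Fin d → ℝ)) (p : ℝ≥0∞) (A : ℝ≥0) : Prop :=
  ∀ f : (Fin d → ℝ) → C, MemLp f p μ →
    eLpNorm (dyadicOperator 𝒟 l μ f) p μ ≤ A * eLpNorm f p μ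

/-- For a (finite or infinite) collection `𝒮` of dyadic cubes: the operators
`T_λ(· μ) : L^p_C(μ) → L^p_D(μ)` are bounded uniformly over the finite subcollections of `𝒮`. -/
def DyadicOperatorBounded {d : ℕ} {C D : Type*} [NormedAddCommGroup C] [NormedSpace ℝ C]
    [NormedAddCommGroup D] [NormedSpace ℝ D] (𝒮 : Set (DyadicCube d))
    (l : DyadicCube d → C →ₗ[ℝ] D) (μ : Measure (Fin d → ℝ)) (p : ℝ≥0∞) : Prop :=
  ∃ A : ℝ≥0, ∀ 𝒟 : Finset (DyadicCube d), (𝒟 : Set (DyadicCube d)) ⊆ 𝒮 →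
    DyadicOperatorBound 𝒟 l μ p A

/-!
The bilinear form `∫ ⟨g, T_λ(f μ)⟩ dμ = ∑_Q ⟨∫_Q g dμ, λ_Q ∫_Q f dμ⟩`, with `f ≥ 0`, is dominated by
`∫ M‖f‖ M‖g‖ dμ`, where `M` is the scalar dyadic maximal operator of the measure `μ`
(`DyadicOperatorBound.dyadicForm_le_lintegral`).  The constant involves only the bound of the
operator on the given `L^p`, the exponent `p` itself having cancelled.  Doob's inequality
(`lintegral_cubeSup_rpow_le`) and duality then yield the bound on every `L^q`.

The domination rests on stopping cubes.  Inside a largest cube `S` of the collection, a cube is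
stopped if it lies in the set where the lattice maximal function of `f` exceeds in norm a large
multiple of `⟨‖f‖⟩_S`, or that of `g` a large multiple of `⟨‖g‖⟩_S`.  For the cubes that are not
stopped, `f` and `g` may be replaced by their lattice maximal functions over these cubes: this
increases the form, since the operators `λ_Q` are positive, and produces functions that are bounded
by multiples of `⟨‖f‖⟩_S` and `⟨‖g‖⟩_S`.  On such functions the `L^p` bound of `T_λ` gives what is
needed (`DyadicOperatorBound.dyadicForm_le_average`).  By the weak-type `(1,1)` inequality for the
lattice maximal operators, the stopped cubes cover at most half of `S`, and they are handled by
induction.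

The weak-type inequality is needed for `μ`, which need not be doubling, while the Hardy--Littlewood
property concerns the Lebesgue measure and a single exponent.  The transference goes through finite
binary martingales (`MartingaleTree`).  These are realised on the subcubes of a cube, so that the
property gives a strong-type inequality for them (`MartingaleTree.exists_supAvg_rpow_le`), and
stopping turns it into a weak-type one, as in the Calderón--Zygmund decomposition
(`MartingaleTree.exists_mul_supAvg_exceed_le`).  The associated Burkholder function, the best value
of the weak-type functional over all binary martingales with a given starting point, is midpoint
concave because two martingales can be joined with equal probabilities, hence concave
(`MartingaleTree.concaveOn_burkholder`).  Concavity allows arbitrary transition probabilities, so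
that the inequality passes to every measure (`setIntegral_cubeSup_le`,
`HasHardyLittlewoodProperty.exists_weakType`).  The same induction with the explicit function
`m ^ q - q' * m ^ (q - 1) * x`, where `q' = q / (q - 1)`, proves Doob's inequality.
-/

/-! ### Geometry of dyadic cubes -/

namespace DyadicCube

variable {d : ℕ}

theorem mem_toSet_iff (Q : DyadicCube d) (x : Fin d → ℝ) :
    x ∈ Q.toSet ↔ ∀ i, ⌊(2 : ℝ) ^ Q.k * x i⌋ = Q.j i := by
  refine forall_congr' fun i => ?_
  have h2 : (0 : ℝ) < 2 ^ Q.k := by positivity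
  rw [Int.floor_eq_iff, zpow_neg, inv_mul_le_iff₀ h2, lt_inv_mul_iff₀ h2]

theorem toSet_eq_pi (Q : DyadicCube d) :
    Q.toSet = Set.univ.pi fun i => Set.Ico ((2 : ℝ) ^ (-Q.k) * (Q.j i : ℝ))
      ((2 : ℝ) ^ (-Q.k) * ((Q.j i : ℝ) + 1)) := by
  ext x
  simp [toSet]

@[measurability]
theorem measurableSet_toSet (Q : DyadicCube d) : MeasurableSet Q.toSet := by
  rw [toSet_eq_pi]
  exact MeasurableSet.univ_pi fun i => measurableSet_Ico

theorem volume_toSet (Q : DyadicCube d) :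
    volume Q.toSet = ENNReal.ofReal ((2 : ℝ) ^ (-Q.k)) ^ d := by
  rw [toSet_eq_pi, Real.volume_pi_Ico]
  simp [mul_add]

theorem volume_toSet_ne_zero (Q : DyadicCube d) : volume Q.toSet ≠ 0 := by
  rw [volume_toSet]
  refine pow_ne_zero _ ?_
  rw [Ne, ENNReal.ofReal_eq_zero, not_le]
  positivity

theorem measure_toSet_lt_top (μ : Measure (Fin d → ℝ)) [IsLocallyFiniteMeasure μ]
    (Q : DyadicCube d) : μ Q.toSet < ∞ := by
  refine (measure_mono ?_).trans_lt (isCompact_univ_pi fun i => isCompact_Icc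
    (a := (2 : ℝ) ^ (-Q.k) * (Q.j i : ℝ))
    (b := (2 : ℝ) ^ (-Q.k) * ((Q.j i : ℝ) + 1))).measure_lt_top
  rw [toSet_eq_pi]
  exact Set.pi_mono fun i _ => Set.Ico_subset_Icc_self

/-- Dyadic cubes are nested or disjoint. -/
theorem subset_or_disjoint {Q R : DyadicCube d} (h : Q.k ≤ R.k) :
    R.toSet ⊆ Q.toSet ∨ Disjoint R.toSet Q.toSet := by
  by_cases hd : Disjoint R.toSet Q.toSet
  · exact Or.inr hd
  refine Or.inl fun x hx => ?_
  obtain ⟨y, hyR, hyQ⟩ := Set.not_disjoint_iff.1 hd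
  rw [mem_toSet_iff] at hx hyR hyQ ⊢
  obtain ⟨n, hn⟩ := Int.le.dest h
  -- The coordinate of the coarser cube is the integer quotient of that of the finer one.
  have key : ∀ t : ℝ, ⌊(2 : ℝ) ^ Q.k * t⌋ = ⌊(2 : ℝ) ^ R.k * t⌋ / ((2 ^ n : ℕ) : ℤ) := fun t => by
    rw [← Int.floor_div_natCast (k := ℝ), ← hn, zpow_add₀ two_ne_zero, zpow_natCast]
    congr 1
    push_cast
    field_simp
  intro i
  rw [key, hx i, ← hyR i, ← key, hyQ i]

/-- The `2^d` dyadic children of a cube. -/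
def child (Q : DyadicCube d) (ε : Fin d → Bool) : DyadicCube d :=
  ⟨Q.k + 1, fun i => 2 * Q.j i + (ε i).toInt⟩

theorem child_subset (Q : DyadicCube d) (ε : Fin d → Bool) : (Q.child ε).toSet ⊆ Q.toSet := by
  intro x hx
  rw [mem_toSet_iff] at hx ⊢
  intro i
  have h := hx i
  rw [Int.floor_eq_iff] at h ⊢
  simp only [child, zpow_add_one₀ (two_ne_zero' ℝ)] at h
  push_cast at h
  cases hε : ε i <;> simp only [hε, Bool.toInt] at h <;> norm_num at h <;> constructor <;> linarith

theorem disjoint_child (Q : DyadicCube d) {ε δ : Fin d → Bool} (h : ε ≠ δ) :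
    Disjoint (Q.child ε).toSet (Q.child δ).toSet := by
  rw [Set.disjoint_left]
  intro x hx hy
  rw [mem_toSet_iff] at hx hy
  refine h (funext fun i => ?_)
  have h1 := (hx i).symm.trans (hy i)
  simp only [child] at h1
  cases h2 : ε i <;> cases h3 : δ i <;> simp_all [Bool.toInt]

theorem toSet_eq_iUnion_child (Q : DyadicCube d) :
    Q.toSet = ⋃ ε ∈ (Finset.univ : Finset (Fin d → Bool)), (Q.child ε).toSet := by
  ext x
  simp only [Finset.mem_univ, Set.iUnion_true, Set.mem_iUnion]
  refine ⟨fun hx => ?_, fun ⟨ε, hε⟩ => Q.child_subset ε hε⟩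
  rw [mem_toSet_iff] at hx
  refine ⟨fun i => decide (2 * (Q.j i : ℝ) + 1 ≤ (2 : ℝ) ^ (Q.k + 1) * x i), ?_⟩
  rw [mem_toSet_iff]
  intro i
  have h := hx i
  rw [Int.floor_eq_iff] at h ⊢
  simp only [child, zpow_add_one₀ (two_ne_zero' ℝ)]
  by_cases hc : 2 * (Q.j i : ℝ) + 1 ≤ (2 : ℝ) ^ Q.k * 2 * x i <;>
    simp only [hc, decide_true, decide_false, Bool.toInt, cond_true, cond_false] <;> push_cast <;>
    constructor <;> linarith

theorem pairwiseDisjoint_child (Q : DyadicCube d) (s : Set (Fin d → Bool)) :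
    s.PairwiseDisjoint fun ε => (Q.child ε).toSet :=
  fun _ _ _ _ h => Q.disjoint_child h

theorem volume_child (Q : DyadicCube d) (ε : Fin d → Bool) :
    2 ^ d * volume (Q.child ε).toSet = volume Q.toSet := by
  rw [volume_toSet, volume_toSet, ← mul_pow]
  congr 1
  rw [show (2 : ℝ≥0∞) = ENNReal.ofReal 2 by simp, ← ENNReal.ofReal_mul zero_le_two]
  congr 1
  simp only [child]
  rw [neg_add, zpow_add₀ two_ne_zero]
  norm_num
  ring

/-- Summing over all children a quantity that depends on one coordinate of their position only. -/
theorem sum_child {M : Type*} [AddCommMonoid M] (i : Fin d) (a : Bool → M) :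
    ∑ ε : Fin d → Bool, a (ε i) = 2 ^ (d - 1) • (a true + a false) := by
  classical
  obtain ⟨n, rfl⟩ : ∃ n, d = n + 1 := ⟨d - 1, by have := i.pos; omega⟩
  rw [← (Equiv.funSplitAt i Bool).symm.sum_comp, Fintype.sum_prod_type]
  simp [Equiv.funSplitAt, Equiv.piSplitAt]

end DyadicCube

/-! ### Finite dyadic martingales as binary trees -/

namespace DyadicCube

variable {d : ℕ}

/-- If the integral over every child of `Q` is its volume times a number that depends only on the
position of the child in the coordinate `i`, then the integral over `Q` is its volume times the mean
of the two numbers. -/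
theorem lintegral_eq_of_child (i : Fin d) (Q : DyadicCube d) {F : (Fin d → ℝ) → ℝ≥0∞}
    {c : Bool → ℝ} (hc : ∀ b, 0 ≤ c b)
    (h : ∀ ε, ∫⁻ y in (Q.child ε).toSet, F y =
      volume (Q.child ε).toSet * ENNReal.ofReal (c (ε i))) :
    ∫⁻ y in Q.toSet, F y = volume Q.toSet * ENNReal.ofReal ((c true + c false) / 2) := by
  have hv : ∀ ε, volume (Q.child ε).toSet = volume Q.toSet / 2 ^ d := fun ε => by
    rw [ENNReal.eq_div_iff (by simp) (by simp), volume_child]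
  have hd : d - 1 + 1 = d := by have := i.pos; omega
  rw [toSet_eq_iUnion_child, lintegral_biUnion_finset (Q.pairwiseDisjoint_child _)
    (fun ε _ => measurableSet_toSet _), ← toSet_eq_iUnion_child]
  simp_rw [h, hv]
  rw [← Finset.mul_sum, sum_child i fun b => ENNReal.ofReal (c b),
    ← ENNReal.ofReal_add (hc _) (hc _), nsmul_eq_mul, ENNReal.ofReal_div_of_pos two_pos,
    ENNReal.div_eq_inv_mul, ENNReal.div_eq_inv_mul]
  nth_rw 1 [← hd]
  rw [pow_succ, ENNReal.mul_inv (by simp) (by simp)]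
  push_cast
  calc _ = ((2 : ℝ≥0∞) ^ (d - 1))⁻¹ * 2 ^ (d - 1) * (volume Q.toSet *
        (2⁻¹ * ENNReal.ofReal (c true + c false))) := by ring
    _ = _ := by rw [ENNReal.inv_mul_cancel (by simp) (by simp), one_mul]; simp

theorem integral_eq_of_child {E : Type*} [NormedAddCommGroup E] [NormedSpace ℝ E] (i : Fin d)
    (Q : DyadicCube d) {f : (Fin d → ℝ) → E} {c : Bool → E}
    (hf : ∀ ε, IntegrableOn f (Q.child ε).toSet)
    (h : ∀ ε, ∫ y in (Q.child ε).toSet, f y = volume.real (Q.child ε).toSet • c (ε i)) :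
    ∫ y in Q.toSet, f y = volume.real Q.toSet • ((2⁻¹ : ℝ) • (c false + c true)) := by
  have hv : ∀ ε, volume.real (Q.child ε).toSet = volume.real Q.toSet / 2 ^ d := fun ε => by
    rw [eq_div_iff (by positivity), Measure.real, Measure.real, ← volume_child Q ε]
    simp [mul_comm]
  have hd : d - 1 + 1 = d := by have := i.pos; omega
  rw [toSet_eq_iUnion_child, integral_biUnion_finset _ (fun ε _ => measurableSet_toSet _)
    (Q.pairwiseDisjoint_child _) (fun ε _ => hf ε), ← toSet_eq_iUnion_child]
  simp_rw [h, hv]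
  rw [← Finset.smul_sum, sum_child i c, ← Nat.cast_smul_eq_nsmul ℝ, smul_smul, smul_smul,
    add_comm (c true)]
  congr 1
  have h2 : (2 : ℝ) ^ d = 2 ^ (d - 1) * 2 := by rw [← pow_succ, hd]
  rw [h2]
  push_cast
  field_simp

end DyadicCube

/-- A finite martingale with values in `E` on the dyadic filtration of `[0,1)`, encoded by the tree
of its terminal values: `node l r` moves to `l` or `r` with probability `1/2` each. -/
inductive MartingaleTree (E : Type*) where
  /-- The martingale that is constantly `x`. -/
  | leaf (x : E)
  /-- The martingale that continues as `l` or as `r` with equal probability. -/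
  | node (l r : MartingaleTree E)

namespace MartingaleTree

variable {E : Type*} [NormedAddCommGroup E] [NormedSpace ℝ E] {d : ℕ}

/-- The expectation, that is, the starting point of the martingale. -/
noncomputable def mean : MartingaleTree E → E
  | leaf x => x
  | node l r => (2⁻¹ : ℝ) • (l.mean + r.mean)

/-- The expectation of `Φ` of the terminal value. -/
noncomputable def leafAvg {E : Type*} (Φ : E → ℝ) : MartingaleTree E → ℝ
  | leaf x => Φ x
  | node l r => (l.leafAvg Φ + r.leafAvg Φ) / 2

/-- The expectation of `Φ` of the supremum of `m` and of all values the martingale takes. -/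
noncomputable def supAvg [Lattice E] (Φ : E → ℝ) : E → MartingaleTree E → ℝ
  | m, leaf x => Φ (m ⊔ x)
  | m, node l r => (supAvg Φ (m ⊔ (node l r).mean) l + supAvg Φ (m ⊔ (node l r).mean) r) / 2

theorem leafAvg_nonneg {E : Type*} {Φ : E → ℝ} (hΦ : ∀ x, 0 ≤ Φ x) :
    ∀ T : MartingaleTree E, 0 ≤ T.leafAvg Φ
  | leaf x => hΦ x
  | node l r => by
    have := leafAvg_nonneg hΦ l
    have := leafAvg_nonneg hΦ r
    simp only [leafAvg]
    linarith

section Sup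

variable [Lattice E]

theorem supAvg_nonneg {Φ : E → ℝ} (hΦ : ∀ x, 0 ≤ Φ x) :
    ∀ (m : E) (T : MartingaleTree E), 0 ≤ T.supAvg Φ m
  | m, leaf x => hΦ _
  | m, node l r => by
    have := supAvg_nonneg hΦ (m ⊔ (node l r).mean) l
    have := supAvg_nonneg hΦ (m ⊔ (node l r).mean) r
    simp only [supAvg]
    linarith

theorem supAvg_le {Φ : E → ℝ} {a : ℝ} (hΦ : ∀ x, Φ x ≤ a) :
    ∀ (m : E) (T : MartingaleTree E), T.supAvg Φ m ≤ a
  | m, leaf x => hΦ _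
  | m, node l r => by
    have := supAvg_le hΦ (m ⊔ (node l r).mean) l
    have := supAvg_le hΦ (m ⊔ (node l r).mean) r
    simp only [supAvg]
    linarith

/-- The starting point of the martingale already takes part in the supremum. -/
theorem supAvg_sup_mean (Φ : E → ℝ) (m : E) (T : MartingaleTree E) :
    T.supAvg Φ (m ⊔ T.mean) = T.supAvg Φ m := by
  cases T <;> simp only [supAvg, sup_assoc, sup_idem, mean]

end Sup

/-- The terminal value of the martingale as a function on the cube `Q`: `node l r` is realised as
`l` or `r` on each child of `Q`, according to the position of the child in the coordinate `i`. -/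
noncomputable def realize (i : Fin d) :
    MartingaleTree E → DyadicCube d → (Fin d → ℝ) → E
  | leaf x, Q => Q.toSet.indicator fun _ => x
  | node l r, Q => fun y =>
      ∑ ε : Fin d → Bool, (bif ε i then realize i r (Q.child ε) y else realize i l (Q.child ε) y)

/-- The running supremum of the martingale, started at `m`, as a function on the cube `Q`. -/
noncomputable def realizeSup [Lattice E] (i : Fin d) :
    MartingaleTree E → E → DyadicCube d → (Fin d → ℝ) → E
  | leaf x, m, _ => fun _ => m ⊔ x
  | node l r, m, Q => fun y => ∑ ε : Fin d → Bool, (Q.child ε).toSet.indicator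
      (fun y => bif ε i then realizeSup i r (m ⊔ (node l r).mean) (Q.child ε) y
        else realizeSup i l (m ⊔ (node l r).mean) (Q.child ε) y) y

open Classical in
/-- The cubes on which the martingale is averaged in its realisation on `Q`. -/
noncomputable def cubes (i : Fin d) : MartingaleTree E → DyadicCube d → Finset (DyadicCube d)
  | leaf _, Q => {Q}
  | node l r, Q => insert Q (Finset.univ.biUnion fun ε : Fin d → Bool =>
      bif ε i then cubes i r (Q.child ε) else cubes i l (Q.child ε))

theorem realize_eq_zero {E : Type*} [NormedAddCommGroup E] (i : Fin d) :
    ∀ (T : MartingaleTree E) (Q : DyadicCube d) {y : Fin d → ℝ},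
      y ∉ Q.toSet → T.realize i Q y = 0
  | leaf x, Q, y, hy => Set.indicator_of_notMem hy _
  | node l r, Q, y, hy => Finset.sum_eq_zero fun ε _ => by
    have hy' : y ∉ (Q.child ε).toSet := fun h => hy (Q.child_subset ε h)
    cases ε i
    · exact realize_eq_zero i l _ hy'
    · exact realize_eq_zero i r _ hy'

theorem realize_node_of_mem {E : Type*} [NormedAddCommGroup E] (i : Fin d)
    (l r : MartingaleTree E) (Q : DyadicCube d)
    {ε : Fin d → Bool} {y : Fin d → ℝ} (hy : y ∈ (Q.child ε).toSet) :
    (node l r).realize i Q y =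
      (bif ε i then r else l).realize i (Q.child ε) y := by
  simp only [realize]
  rw [Finset.sum_eq_single ε]
  · cases ε i <;> rfl
  · intro δ _ hδ
    have hy' : y ∉ (Q.child δ).toSet := fun h => Set.disjoint_left.1 (Q.disjoint_child hδ) h hy
    rw [realize_eq_zero i l _ hy', realize_eq_zero i r _ hy', Bool.cond_self]
  · simp

theorem realizeSup_node_of_mem [Lattice E] (i : Fin d) (l r : MartingaleTree E) (m : E)
    (Q : DyadicCube d) {ε : Fin d → Bool} {y : Fin d → ℝ} (hy : y ∈ (Q.child ε).toSet) :
    (node l r).realizeSup i m Q y =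
      (bif ε i then r else l).realizeSup i (m ⊔ (node l r).mean) (Q.child ε) y := by
  simp only [realizeSup]
  rw [Finset.sum_eq_single ε, Set.indicator_of_mem hy]
  · cases ε i <;> rfl
  · intro δ _ hδ
    exact Set.indicator_of_notMem
      (fun h => Set.disjoint_left.1 (Q.disjoint_child hδ) h hy) _
  · simp

theorem stronglyMeasurable_realize {E : Type*} [NormedAddCommGroup E] (i : Fin d) :
    ∀ (T : MartingaleTree E) (Q : DyadicCube d),
    StronglyMeasurable (T.realize i Q)
  | leaf x, Q => stronglyMeasurable_const.indicator Q.measurableSet_toSet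
  | node l r, Q => by
    refine Finset.stronglyMeasurable_fun_sum _ fun ε _ => ?_
    cases ε i
    · exact stronglyMeasurable_realize i l _
    · exact stronglyMeasurable_realize i r _

theorem lintegral_realize {E : Type*} [NormedAddCommGroup E] (i : Fin d) {Φ : E → ℝ}
    (hΦ : ∀ x, 0 ≤ Φ x) :
    ∀ (T : MartingaleTree E) (Q : DyadicCube d),
      ∫⁻ y in Q.toSet, ENNReal.ofReal (Φ (T.realize i Q y)) =
        volume Q.toSet * ENNReal.ofReal (T.leafAvg Φ)
  | leaf x, Q => by
    rw [setLIntegral_congr_fun (g := fun _ => ENNReal.ofReal (Φ x)) Q.measurableSet_toSet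
      fun y hy => by simp only [realize, Set.indicator_of_mem hy]]
    simp [leafAvg, mul_comm]
  | node l r, Q => by
    rw [Q.lintegral_eq_of_child i (c := fun b => (bif b then r else l).leafAvg Φ)
      (fun b => leafAvg_nonneg hΦ _) fun ε => ?_]
    · simp [leafAvg, add_comm]
    · rw [setLIntegral_congr_fun (DyadicCube.measurableSet_toSet _)
        fun y hy => by rw [realize_node_of_mem i l r Q hy]]
      cases ε i
      · exact lintegral_realize i hΦ l _
      · exact lintegral_realize i hΦ r _

theorem lintegral_realizeSup [Lattice E] (i : Fin d) {Φ : E → ℝ} (hΦ : ∀ x, 0 ≤ Φ x) :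
    ∀ (T : MartingaleTree E) (m : E) (Q : DyadicCube d),
      ∫⁻ y in Q.toSet, ENNReal.ofReal (Φ (T.realizeSup i m Q y)) =
        volume Q.toSet * ENNReal.ofReal (T.supAvg Φ m)
  | leaf x, m, Q => by
    simp [realizeSup, supAvg, mul_comm]
  | node l r, m, Q => by
    rw [Q.lintegral_eq_of_child i
      (c := fun b => (bif b then r else l).supAvg Φ (m ⊔ (node l r).mean))
      (fun b => supAvg_nonneg hΦ _ _) fun ε => ?_]
    · simp [supAvg, add_comm]
    · rw [setLIntegral_congr_fun (DyadicCube.measurableSet_toSet _)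
        fun y hy => by rw [realizeSup_node_of_mem i l r m Q hy]]
      cases ε i
      · exact lintegral_realizeSup i hΦ l _ _
      · exact lintegral_realizeSup i hΦ r _ _

theorem integrableOn_realize {E : Type*} [NormedAddCommGroup E] (i : Fin d)
    (T : MartingaleTree E) (Q : DyadicCube d) :
    IntegrableOn (T.realize i Q) Q.toSet := by
  refine ⟨(T.stronglyMeasurable_realize i Q).aestronglyMeasurable, ?_⟩
  have h := T.lintegral_realize i (Φ := fun x => ‖x‖) (fun x => norm_nonneg x) Q
  simp only [ofReal_norm] at h
  rw [HasFiniteIntegral, h]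
  exact ENNReal.mul_lt_top (Q.measure_toSet_lt_top _) ENNReal.ofReal_lt_top

theorem integral_realize [CompleteSpace E] (i : Fin d) :
    ∀ (T : MartingaleTree E) (Q : DyadicCube d),
      ∫ y in Q.toSet, T.realize i Q y = volume.real Q.toSet • T.mean
  | leaf x, Q => by
    rw [setIntegral_congr_fun (g := fun _ => x) Q.measurableSet_toSet
      fun y hy => by simp only [realize, Set.indicator_of_mem hy]]
    exact setIntegral_const x
  | node l r, Q => by
    have key : ∀ ε, Set.EqOn ((node l r).realize i Q)
      ((bif ε i then r else l).realize i (Q.child ε)) (Q.child ε).toSet := fun ε y hy =>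
        realize_node_of_mem i l r Q hy
    rw [Q.integral_eq_of_child i (c := fun b => (bif b then r else l).mean)
      (fun ε => ?_) fun ε => ?_]
    · simp [mean]
    · exact (integrableOn_congr_fun (key ε) (DyadicCube.measurableSet_toSet _)).2
        (integrableOn_realize i _ _)
    · rw [setIntegral_congr_fun (DyadicCube.measurableSet_toSet _) (key ε)]
      cases ε i
      · exact integral_realize i l _
      · exact integral_realize i r _

/-- On `Q`, the running supremum is dominated by the lattice supremum of `m` and of the averages of
the realisation. -/
theorem realizeSup_le [CompleteSpace E] [Lattice E] (i : Fin d) {f : (Fin d → ℝ) → E} :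
    ∀ (T : MartingaleTree E) (m : E) (Q : DyadicCube d) {y : Fin d → ℝ} {z : E},
      Set.EqOn f (T.realize i Q) Q.toSet → y ∈ Q.toSet → m ≤ z →
      (∀ R ∈ T.cubes i Q, y ∈ R.toSet → ⨍ x in R.toSet, f x ≤ z) → T.realizeSup i m Q y ≤ z := by
  have avg : ∀ (T : MartingaleTree E) (Q : DyadicCube d),
      Set.EqOn f (T.realize i Q) Q.toSet → ⨍ x in Q.toSet, f x = T.mean := fun T Q h => by
    rw [setAverage_eq, setIntegral_congr_fun Q.measurableSet_toSet h, integral_realize, smul_smul,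
      inv_mul_cancel₀, one_smul]
    exact (ENNReal.toReal_pos Q.volume_toSet_ne_zero (Q.measure_toSet_lt_top _).ne).ne'
  intro T
  induction T with
  | leaf x =>
    intro m Q y z hf hy hm h
    have h1 := h Q (by simp [cubes]) hy
    rw [avg _ _ hf] at h1
    exact sup_le hm h1
  | node l r hl hr =>
    intro m Q y z hf hy hm h
    have h1 := h Q (by simp [cubes]) hy
    rw [avg _ _ hf] at h1
    obtain ⟨ε, hε⟩ : ∃ ε, y ∈ (Q.child ε).toSet := by
      rw [Q.toSet_eq_iUnion_child] at hy
      simpa using hy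
    have hf' : Set.EqOn f ((bif ε i then r else l).realize i (Q.child ε)) (Q.child ε).toSet :=
      fun y hy => (hf (Q.child_subset ε hy)).trans (realize_node_of_mem i l r Q hy)
    have hc : ∀ R ∈ (bif ε i then r else l).cubes i (Q.child ε), R ∈ (node l r).cubes i Q := by
      intro R hR
      simp only [cubes, Finset.mem_insert, Finset.mem_biUnion, Finset.mem_univ, true_and]
      refine Or.inr ⟨ε, ?_⟩
      revert hR
      cases ε i <;> exact id
    rw [realizeSup_node_of_mem i l r m Q hε]
    have hz := sup_le hm h1
    revert hf' hc
    cases ε i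
    · exact fun hf' hc => hl _ _ hf' hε hz fun R hR => h R (hc R hR)
    · exact fun hf' hc => hr _ _ hf' hε hz fun R hR => h R (hc R hR)

theorem le_realizeSup [Lattice E] (i : Fin d) :
    ∀ (T : MartingaleTree E) (m : E) (Q : DyadicCube d) {y : Fin d → ℝ}, y ∈ Q.toSet →
      m ≤ T.realizeSup i m Q y
  | leaf x, m, Q, y, _ => le_sup_left
  | node l r, m, Q, y, hy => by
    obtain ⟨ε, hε⟩ : ∃ ε, y ∈ (Q.child ε).toSet := by
      rw [Q.toSet_eq_iUnion_child] at hy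
      simpa using hy
    rw [realizeSup_node_of_mem i l r m Q hε]
    refine le_trans (le_sup_left (b := (node l r).mean)) ?_
    cases ε i
    · exact le_realizeSup i l _ _ hε
    · exact le_realizeSup i r _ _ hε

theorem cubes_nonempty {E : Type*} (i : Fin d) (T : MartingaleTree E) (Q : DyadicCube d) :
    (T.cubes i Q).Nonempty :=
  ⟨Q, by cases T <;> simp [cubes]⟩

end MartingaleTree

/-! ### The maximal inequality for finite dyadic martingales -/

theorem ofReal_norm_rpow {E : Type*} [NormedAddCommGroup E] (x : E) {p : ℝ} (hp : 0 ≤ p) :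
    ENNReal.ofReal (‖x‖ ^ p) = ‖x‖ₑ ^ p := by
  rw [← ENNReal.ofReal_rpow_of_nonneg (norm_nonneg x) hp, ofReal_norm]

namespace MartingaleTree

variable {E : Type*} [NormedAddCommGroup E] [NormedSpace ℝ E] {d : ℕ}

/-- The Hardy--Littlewood property controls the running supremum of every finite dyadic
martingale, since such a martingale can be realised on the dyadic subcubes of a cube. -/
theorem exists_supAvg_rpow_le [CompleteSpace E] [Lattice E] [HasSolidNorm E]
    [IsOrderedAddMonoid E] (i : Fin d)
    (h : HasHardyLittlewoodProperty d E) :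
    ∃ p : ℝ, 1 < p ∧ ∃ K : ℝ, 0 ≤ K ∧ ∀ T : MartingaleTree E,
      T.supAvg (fun x => ‖x‖ ^ p) 0 ≤ K * T.leafAvg (fun x => ‖x‖ ^ p) := by
  obtain ⟨p, hp1, hp, K, hK⟩ := h
  have hp0 : p ≠ 0 := (zero_lt_one.trans hp1).ne'
  have hr : 1 < p.toReal := by
    rw [← ENNReal.toReal_one]
    exact (ENNReal.toReal_lt_toReal ENNReal.one_ne_top hp.ne).2 hp1
  have hr0 : 0 < p.toReal := zero_lt_one.trans hr
  refine ⟨p.toReal, hr, (K : ℝ) ^ p.toReal, by positivity, fun T => ?_⟩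
  set Q : DyadicCube d := ⟨0, 0⟩
  set f := T.realize i Q
  have hΦ : ∀ x : E, 0 ≤ ‖x‖ ^ p.toReal := fun x => by positivity
  have hf : ∫⁻ y, ‖f y‖ₑ ^ p.toReal =
      volume Q.toSet * ENNReal.ofReal (T.leafAvg fun x => ‖x‖ ^ p.toReal) := by
    rw [← T.lintegral_realize i hΦ, ← lintegral_indicator Q.measurableSet_toSet]
    refine lintegral_congr fun y => ?_
    by_cases hy : y ∈ Q.toSet
    · rw [Set.indicator_of_mem hy, ofReal_norm_rpow _ hr0.le]
    · rw [Set.indicator_of_notMem hy, show f y = 0 from T.realize_eq_zero i Q hy, enorm_zero,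
        ENNReal.zero_rpow_of_pos hr0]
  have hmem : MemLp f p volume := by
    refine ⟨(T.stronglyMeasurable_realize i Q).aestronglyMeasurable, ?_⟩
    rw [eLpNorm_lt_top_iff_lintegral_rpow_enorm_lt_top hp0 hp.ne, hf]
    exact ENNReal.mul_lt_top (Q.measure_toSet_lt_top _) ENNReal.ofReal_lt_top
  have hne := T.cubes_nonempty i Q
  have hmax := hK _ hne f hmem
  rw [eLpNorm_eq_lintegral_rpow_enorm_toReal hp0 hp.ne,
    eLpNorm_eq_lintegral_rpow_enorm_toReal hp0 hp.ne, hf, one_div,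
    ENNReal.rpow_inv_le_iff hr0, ENNReal.mul_rpow_of_nonneg _ _ hr0.le, ← ENNReal.rpow_mul,
    inv_mul_cancel₀ hr0.ne', ENNReal.rpow_one] at hmax
  -- The running supremum lies between `0` and the positive part of the maximal function.
  have hle : ∀ y ∈ Q.toSet, ‖T.realizeSup i 0 Q y‖ ≤
      ‖latticeMaximal (T.cubes i Q) hne f y‖ := by
    intro y hy
    set L := latticeMaximal (T.cubes i Q) hne f y with hL
    have h1 : T.realizeSup i 0 Q y ≤ L⁺ := by
      refine T.realizeSup_le i 0 Q (Set.eqOn_refl f _) hy (posPart_nonneg L) fun R hR hyR => ?_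
      refine le_trans ?_ (le_posPart L)
      have h2 := Finset.le_sup' (fun R : DyadicCube d =>
        R.toSet.indicator (fun _ => ⨍ x in R.toSet, f x) y) hR
      rw [Set.indicator_of_mem hyR] at h2
      exact h2
    have h0 : 0 ≤ T.realizeSup i 0 Q y := T.le_realizeSup i 0 Q hy
    refine norm_le_norm_of_abs_le_abs ?_
    rw [abs_of_nonneg h0]
    exact h1.trans (sup_le (le_abs_self L) (abs_nonneg L))
  have hint : volume Q.toSet * ENNReal.ofReal (T.supAvg (fun x => ‖x‖ ^ p.toReal) 0) ≤
      ∫⁻ y, ‖latticeMaximal (T.cubes i Q) hne f y‖ₑ ^ p.toReal := by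
    rw [← T.lintegral_realizeSup i hΦ]
    refine (setLIntegral_mono' Q.measurableSet_toSet fun y hy => ?_).trans
      (setLIntegral_le_lintegral _ _)
    rw [← ofReal_norm_rpow _ hr0.le]
    have := hle y hy
    gcongr
  have hfin := hint.trans hmax
  rw [mul_left_comm, ENNReal.mul_le_mul_iff_right Q.volume_toSet_ne_zero
    (Q.measure_toSet_lt_top _).ne, ← ENNReal.ofReal_coe_nnreal,
    ENNReal.ofReal_rpow_of_nonneg (NNReal.coe_nonneg K) hr0.le,
    ← ENNReal.ofReal_mul (by positivity),
    ENNReal.ofReal_le_ofReal_iff (mul_nonneg (by positivity) (leafAvg_nonneg hΦ T))] at hfin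
  exact hfin

/-- The tree stopped at the first node where the conditional expectation of the norm of the
terminal value exceeds `t`. -/
noncomputable def truncate (t : ℝ) : MartingaleTree E → MartingaleTree E
  | leaf x => leaf x
  | node l r => if t < (node l r).leafAvg norm then leaf (node l r).mean
      else node (l.truncate t) (r.truncate t)

/-- The probability that the conditional expectation of the norm of the terminal value exceeds `t`
at some time. -/
noncomputable def truncateProb {E : Type*} [NormedAddCommGroup E] (t : ℝ) : MartingaleTree E → ℝ
  | leaf x => if t < ‖x‖ then 1 else 0
  | node l r => if t < (node l r).leafAvg norm then 1 else (l.truncateProb t + r.truncateProb t) / 2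

theorem mean_truncate (t : ℝ) : ∀ T : MartingaleTree E, (T.truncate t).mean = T.mean
  | leaf x => rfl
  | node l r => by
    rw [truncate]
    split_ifs
    · rfl
    · simp only [mean, mean_truncate t l, mean_truncate t r]

theorem norm_mean_le : ∀ T : MartingaleTree E, ‖T.mean‖ ≤ T.leafAvg norm
  | leaf x => le_rfl
  | node l r => by
    have hl := norm_mean_le l
    have hr := norm_mean_le r
    have h := norm_add_le l.mean r.mean
    simp only [mean, leafAvg, norm_smul, norm_inv, Real.norm_ofNat]
    linarith

theorem leafAvg_norm_nonneg {E : Type*} [NormedAddCommGroup E] (T : MartingaleTree E) :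
    0 ≤ T.leafAvg norm :=
  leafAvg_nonneg norm_nonneg T

theorem leafAvg_truncate_le (t : ℝ) : ∀ T : MartingaleTree E,
    (T.truncate t).leafAvg norm ≤ T.leafAvg norm
  | leaf x => le_rfl
  | node l r => by
    rw [truncate]
    split_ifs
    · exact norm_mean_le _
    · have := leafAvg_truncate_le t l
      have := leafAvg_truncate_le t r
      simp only [leafAvg]
      linarith

theorem mul_truncateProb_le {E : Type*} [NormedAddCommGroup E] {t : ℝ} (ht : 0 < t) :
    ∀ T : MartingaleTree E, t * T.truncateProb t ≤ T.leafAvg norm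
  | leaf x => by
    rw [truncateProb]
    split_ifs with h
    · simpa [leafAvg] using h.le
    · simp [leafAvg]
  | node l r => by
    rw [truncateProb]
    split_ifs with h
    · simpa using h.le
    · have := mul_truncateProb_le ht l
      have := mul_truncateProb_le ht r
      simp only [leafAvg]
      linarith

/-- The terminal values of the stopped martingale are bounded by `2 t`, because the expectation of
the norm at most doubles in one step. -/
theorem leafAvg_rpow_truncate_le {t p : ℝ} (hp : 1 < p) : ∀ T : MartingaleTree E,
    T.leafAvg norm ≤ 2 * t →
      (T.truncate t).leafAvg (fun x => ‖x‖ ^ p) ≤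
        (2 * t) ^ (p - 1) * (T.truncate t).leafAvg norm := by
  have key : ∀ x : E, ‖x‖ ≤ 2 * t → ‖x‖ ^ p ≤ (2 * t) ^ (p - 1) * ‖x‖ := fun x hx => by
    calc ‖x‖ ^ p = ‖x‖ ^ (p - 1) * ‖x‖ := by
          rw [← Real.rpow_add_one' (norm_nonneg x) (by linarith)]
          simp
      _ ≤ _ := by
          have : 0 ≤ p - 1 := by linarith
          gcongr
  intro T
  induction T with
  | leaf x => exact fun h => key x h
  | node l r hl hr =>
    intro h
    rw [truncate]
    split_ifs with hs
    · exact key _ ((norm_mean_le _).trans h)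
    · have h0l := leafAvg_norm_nonneg l
      have h0r := leafAvg_norm_nonneg r
      simp only [leafAvg, not_lt] at hs ⊢
      have := hl (by linarith)
      have := hr (by linarith)
      linarith

/-- The running supremum is changed by stopping only where the stopping criterion is met. -/
theorem supAvg_le_supAvg_truncate [Lattice E] (t : ℝ) {Φ : E → ℝ} (h0 : ∀ x, 0 ≤ Φ x)
    (h1 : ∀ x, Φ x ≤ 1) : ∀ (m : E) (T : MartingaleTree E),
      T.supAvg Φ m ≤ (T.truncate t).supAvg Φ m + T.truncateProb t
  | m, leaf x => by
    rw [truncate, truncateProb]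
    split_ifs <;> linarith
  | m, node l r => by
    rw [truncate, truncateProb]
    split_ifs
    · linarith [supAvg_le h1 m (node l r), supAvg_nonneg h0 m (leaf (node l r).mean)]
    · have := supAvg_le_supAvg_truncate t h0 h1 (m ⊔ (node l r).mean) l
      have := supAvg_le_supAvg_truncate t h0 h1 (m ⊔ (node l r).mean) r
      have e : (node (l.truncate t) (r.truncate t)).mean = (node l r).mean := by
        simp only [mean, mean_truncate]
      simp only [supAvg, e]
      linarith

theorem supAvg_mono_fun [Lattice E] {Φ Ψ : E → ℝ} (h : ∀ x, Φ x ≤ Ψ x) :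
    ∀ (m : E) (T : MartingaleTree E), T.supAvg Φ m ≤ T.supAvg Ψ m
  | m, leaf x => h _
  | m, node l r => by
    have := supAvg_mono_fun h (m ⊔ (node l r).mean) l
    have := supAvg_mono_fun h (m ⊔ (node l r).mean) r
    simp only [supAvg]
    linarith

theorem supAvg_const_mul [Lattice E] (c : ℝ) (Φ : E → ℝ) :
    ∀ (m : E) (T : MartingaleTree E), T.supAvg (fun x => c * Φ x) m = c * T.supAvg Φ m
  | m, leaf x => rfl
  | m, node l r => by
    simp only [supAvg, supAvg_const_mul c Φ _ l, supAvg_const_mul c Φ _ r]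
    ring

/-- The indicator function of `{x : t < ‖x‖}`. -/
noncomputable def exceed {E : Type*} [NormedAddCommGroup E] (t : ℝ) (x : E) : ℝ :=
  if t < ‖x‖ then 1 else 0

theorem exceed_nonneg {E : Type*} [NormedAddCommGroup E] (t : ℝ) (x : E) : 0 ≤ exceed t x := by
  rw [exceed]; split_ifs <;> norm_num

theorem exceed_le_one {E : Type*} [NormedAddCommGroup E] (t : ℝ) (x : E) : exceed t x ≤ 1 := by
  rw [exceed]; split_ifs <;> norm_num

/-- The weak-type `(1,1)` maximal inequality, from the strong-type inequality by stopping. -/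
theorem exists_mul_supAvg_exceed_le [CompleteSpace E] [Lattice E] [HasSolidNorm E]
    [IsOrderedAddMonoid E] (i : Fin d)
    (h : HasHardyLittlewoodProperty d E) :
    ∃ W : ℝ, 1 ≤ W ∧ ∀ t : ℝ, 0 < t → ∀ T : MartingaleTree E,
      t * T.supAvg (exceed t) 0 ≤ W * T.leafAvg norm := by
  obtain ⟨p, hp, K, hK, hT⟩ := exists_supAvg_rpow_le i h
  refine ⟨1 + K * 2 ^ (p - 1), le_add_of_nonneg_right (by positivity), fun t ht T => ?_⟩
  have hS := leafAvg_norm_nonneg T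
  have hK2 : 0 ≤ K * (2 : ℝ) ^ (p - 1) := by positivity
  -- If `T` is stopped at once, the claim is trivial, as `W ≥ 1` and probabilities are at most `1`.
  rcases lt_or_ge t (T.leafAvg norm) with hlt | hge
  · have h1 := supAvg_le (exceed_le_one t) 0 T
    nlinarith
  have h1 := supAvg_le_supAvg_truncate t (exceed_nonneg t) (exceed_le_one t) 0 T
  have h2 := mul_truncateProb_le ht T
  have h3 : t ^ p * (T.truncate t).supAvg (exceed t) 0 ≤
      t ^ p * ((K * 2 ^ (p - 1)) * T.leafAvg norm / t) := by
    calc t ^ p * (T.truncate t).supAvg (exceed t) 0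
        = (T.truncate t).supAvg (fun x => t ^ p * exceed t x) 0 := (supAvg_const_mul _ _ _ _).symm
      _ ≤ (T.truncate t).supAvg (fun x => ‖x‖ ^ p) 0 := by
          refine supAvg_mono_fun (fun x => ?_) _ _
          rw [exceed]
          split_ifs with hx
          · rw [mul_one]
            gcongr
          · rw [mul_zero]
            positivity
      _ ≤ K * (T.truncate t).leafAvg (fun x => ‖x‖ ^ p) := hT _
      _ ≤ K * ((2 * t) ^ (p - 1) * T.leafAvg norm) := by
          refine mul_le_mul_of_nonneg_left ?_ hK
          refine (leafAvg_rpow_truncate_le hp T (by linarith)).trans ?_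
          exact mul_le_mul_of_nonneg_left (leafAvg_truncate_le t T) (by positivity)
      _ = _ := by
          rw [Real.mul_rpow zero_le_two ht.le, Real.rpow_sub_one ht.ne']
          ring
  have h4 := le_of_mul_le_mul_left h3 (by positivity)
  rw [le_div_iff₀ ht] at h4
  nlinarith

end MartingaleTree

/-! ### Burkholder functions and finite families of dyadic cubes -/

section CubeSup

variable {E : Type*} {d : ℕ}

open Classical in
/-- The supremum at the point `y` of `m` and of the values `a Q` over the cubes `Q ∈ 𝒟` that
contain `y`. -/
noncomputable def cubeSup [Lattice E] (𝒟 : Finset (DyadicCube d)) (a : DyadicCube d → E) (m : E)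
    (y : Fin d → ℝ) : E :=
  (Finset.insertNone 𝒟).sup' Finset.insertNone_nonempty
    fun o => o.elim m fun Q => if y ∈ Q.toSet then a Q else m

variable [Lattice E] {𝒟 : Finset (DyadicCube d)} {a : DyadicCube d → E} {m : E} {y : Fin d → ℝ}

theorem cubeSup_le_iff {z : E} :
    cubeSup 𝒟 a m y ≤ z ↔ m ≤ z ∧ ∀ Q ∈ 𝒟, y ∈ Q.toSet → a Q ≤ z := by
  rw [cubeSup, Finset.sup'_le_iff]
  constructor
  · refine fun h => ⟨h none (by simp), fun Q hQ hy => ?_⟩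
    simpa [hy] using h (some Q) (by simpa using hQ)
  · rintro ⟨h0, h⟩ (_ | Q) hQ
    · exact h0
    · rw [Finset.some_mem_insertNone] at hQ
      by_cases hy : y ∈ Q.toSet
      · simpa [hy] using h Q hQ hy
      · simpa [hy] using h0

theorem le_cubeSup : m ≤ cubeSup 𝒟 a m y := (cubeSup_le_iff.1 le_rfl).1

theorem apply_le_cubeSup {Q : DyadicCube d} (hQ : Q ∈ 𝒟) (hy : y ∈ Q.toSet) :
    a Q ≤ cubeSup 𝒟 a m y := (cubeSup_le_iff.1 le_rfl).2 Q hQ hy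

theorem cubeSup_mono {ℰ : Finset (DyadicCube d)} (h : ℰ ⊆ 𝒟) :
    cubeSup ℰ a m y ≤ cubeSup 𝒟 a m y :=
  cubeSup_le_iff.2 ⟨le_cubeSup, fun _ hQ hy => apply_le_cubeSup (h hQ) hy⟩

theorem cubeSup_of_forall_notMem (h : ∀ Q ∈ 𝒟, y ∉ Q.toSet) : cubeSup 𝒟 a m y = m :=
  le_antisymm (cubeSup_le_iff.2 ⟨le_rfl, fun Q hQ hy => (h Q hQ hy).elim⟩) le_cubeSup

theorem stronglyMeasurable_cubeSup [TopologicalSpace E] [ContinuousSup E]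
    (𝒟 : Finset (DyadicCube d)) (a : DyadicCube d → E) (m : E) :
    StronglyMeasurable (cubeSup 𝒟 a m) := by
  classical
  induction 𝒟 using Finset.induction_on with
  | empty =>
    have : cubeSup ∅ a m = fun _ => m := funext fun y => cubeSup_of_forall_notMem (by simp)
    rw [this]
    exact stronglyMeasurable_const
  | insert Q 𝒟 _ ih =>
    have : cubeSup (insert Q 𝒟) a m =
        fun y => cubeSup 𝒟 a m y ⊔ Q.toSet.piecewise (fun _ => a Q) (fun _ => m) y := by
      funext y
      refine eq_of_forall_ge_iff fun z => ?_
      rw [sup_le_iff, cubeSup_le_iff, cubeSup_le_iff]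
      by_cases hy : y ∈ Q.toSet
      · simp [hy]; tauto
      · simp [hy]; tauto
    rw [this]
    exact ih.sup (StronglyMeasurable.piecewise Q.measurableSet_toSet stronglyMeasurable_const
      stronglyMeasurable_const)

end CubeSup

section Burkholder

variable {E : Type*} [NormedAddCommGroup E] [NormedSpace ℝ E] {d : ℕ}

theorem measureReal_smul_setAverage {α : Type*} [MeasurableSpace α] {μ : Measure α} {A : Set α}
    (hA : μ A ≠ ∞) (f : α → E) : μ.real A • ⨍ y in A, f y ∂μ = ∫ y in A, f y ∂μ := by
  rw [setAverage_eq, smul_smul]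
  by_cases h : μ.real A = 0
  · rw [h, zero_mul, zero_smul, Measure.restrict_eq_zero.2, integral_zero_measure]
    exact (measureReal_eq_zero_iff hA).1 h
  · rw [mul_inv_cancel₀ h, one_smul]

theorem ConcaveOn.add_setAverage_le {α : Type*} [MeasurableSpace α] {μ : Measure α} {φ : E → ℝ}
    (hφ : ConcaveOn ℝ Set.univ φ) {A B : Set α} {f : α → E} (hB : MeasurableSet B)
    (hA : MeasurableSet A) (hBA : B ⊆ A) (hμ : μ A ≠ ∞) (hf : IntegrableOn f A μ) :
    μ.real B * φ (⨍ y in B, f y ∂μ) + μ.real (A \ B) * φ (⨍ y in A \ B, f y ∂μ) ≤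
      μ.real A * φ (⨍ y in A, f y ∂μ) := by
  have hB' : μ B ≠ ∞ := measure_ne_top_of_subset hBA hμ
  have hC' : μ (A \ B) ≠ ∞ := measure_ne_top_of_subset Set.sdiff_subset hμ
  have hsum : μ.real B + μ.real (A \ B) = μ.real A := by
    rw [← measureReal_union Set.disjoint_sdiff_right (hA.diff hB) hB' hC',
      Set.union_sdiff_cancel hBA]
  have hB0 : 0 ≤ μ.real B := measureReal_nonneg
  have hC0 : 0 ≤ μ.real (A \ B) := measureReal_nonneg
  rcases (measureReal_nonneg (μ := μ) (s := A)).eq_or_lt with h0 | h0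
  · have e1 : μ.real B = 0 := by linarith
    have e2 : μ.real (A \ B) = 0 := by linarith
    rw [← h0, e1, e2]
    simp
  have havg := average_union (f := f)
    (Set.disjoint_sdiff_right.aedisjoint (μ := μ) (s := B) (t := A \ B))
    (hA.diff hB).nullMeasurableSet hB' hC' (hf.mono_set hBA) (hf.mono_set Set.sdiff_subset)
  rw [Set.union_sdiff_cancel hBA, hsum] at havg
  have h := hφ.2 (Set.mem_univ (⨍ y in B, f y ∂μ)) (Set.mem_univ (⨍ y in A \ B, f y ∂μ))
    (div_nonneg hB0 h0.le) (div_nonneg hC0 h0.le) (by rw [← add_div, hsum, div_self h0.ne'])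
  rw [← havg] at h
  have h2 := mul_le_mul_of_nonneg_left h h0.le
  refine le_trans (le_of_eq ?_) h2
  simp only [smul_eq_mul]
  field_simp

/-- **Burkholder's method.**  Let `V m` be concave and suppose that `V` does not increase when the
first argument, which stands for the running supremum, is updated by the second, which stands for
the running average.  If a functional `ψ` satisfies Jensen's inequality against `V` as long as the
running supremum does not move, then it does so with the supremum over any finite family of dyadic
cubes, with respect to any measure. -/
theorem setIntegral_cubeSup_le [Lattice E] {μ : Measure (Fin d → ℝ)} {V ψ : E → E → ℝ}
    {f : (Fin d → ℝ) → E} {m₀ : E}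
    (hconc : ∀ m, m₀ ≤ m → ConcaveOn ℝ Set.univ (V m))
    (hsup : ∀ m, m₀ ≤ m → ∀ x, V (m ⊔ x) x ≤ V m x)
    (hbase : ∀ m, m₀ ≤ m → ∀ B, MeasurableSet B → μ B ≠ ∞ → IntegrableOn f B μ →
      IntegrableOn (fun y => ψ m (f y)) B μ ∧
        ∫ y in B, ψ m (f y) ∂μ ≤ μ.real B * V m (⨍ y in B, f y ∂μ))
    (𝒟 : Finset (DyadicCube d)) :
    ∀ m, m₀ ≤ m → ∀ A, MeasurableSet A → μ A ≠ ∞ → IntegrableOn f A μ →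
      (∀ Q ∈ 𝒟, Q.toSet ⊆ A) →
      IntegrableOn (fun y => ψ (cubeSup 𝒟 (fun Q => ⨍ z in Q.toSet, f z ∂μ) m y) (f y)) A μ ∧
        ∫ y in A, ψ (cubeSup 𝒟 (fun Q => ⨍ z in Q.toSet, f z ∂μ) m y) (f y) ∂μ ≤
          μ.real A * V m (⨍ y in A, f y ∂μ) := by
  classical
  induction 𝒟 using Finset.strongInduction with
  | H 𝒟 ih =>
  intro m hm A hA hμ hf hsub
  set a : DyadicCube d → E := fun Q => ⨍ z in Q.toSet, f z ∂μ with ha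
  rcases 𝒟.eq_empty_or_nonempty with rfl | hne
  · have h : ∀ y, cubeSup ∅ a m y = m := fun y => cubeSup_of_forall_notMem (by simp)
    simp only [h]
    exact hbase m hm A hA hμ hf
  obtain ⟨Q, hQ, hmin⟩ := 𝒟.exists_min_image (fun Q => Q.k) hne
  -- `Q` is a largest cube: the other ones lie in `Q` or in its complement.
  set 𝒟₁ := (𝒟.erase Q).filter fun R => R.toSet ⊆ Q.toSet
  set 𝒟₂ := (𝒟.erase Q).filter fun R => Disjoint R.toSet Q.toSet
  have h1 : 𝒟₁ ⊂ 𝒟 := (Finset.filter_subset _ _).trans_ssubset (Finset.erase_ssubset hQ)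
  have h2 : 𝒟₂ ⊂ 𝒟 := (Finset.filter_subset _ _).trans_ssubset (Finset.erase_ssubset hQ)
  have hcase : ∀ R ∈ 𝒟, R = Q ∨ R ∈ 𝒟₁ ∨ R ∈ 𝒟₂ := fun R hR => by
    by_cases hRQ : R = Q
    · exact Or.inl hRQ
    · refine Or.inr ?_
      simp only [𝒟₁, 𝒟₂, Finset.mem_filter, Finset.mem_erase]
      rcases DyadicCube.subset_or_disjoint (hmin R hR) with h | h
      · exact Or.inl ⟨⟨hRQ, hR⟩, h⟩
      · exact Or.inr ⟨⟨hRQ, hR⟩, h⟩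
  have hQA := hsub Q hQ
  have e1 : ∀ y ∈ Q.toSet, cubeSup 𝒟 a m y = cubeSup 𝒟₁ a (m ⊔ a Q) y := fun y hy => by
    refine eq_of_forall_ge_iff fun z => ?_
    rw [cubeSup_le_iff, cubeSup_le_iff, sup_le_iff]
    constructor
    · exact fun h => ⟨⟨h.1, h.2 Q hQ hy⟩, fun R hR => h.2 R (h1.1 hR)⟩
    · refine fun h => ⟨h.1.1, fun R hR hyR => ?_⟩
      rcases hcase R hR with rfl | h3 | h3
      · exact h.1.2
      · exact h.2 R h3 hyR
      · exact (Set.disjoint_left.1 (Finset.mem_filter.1 h3).2 hyR hy).elim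
  have e2 : ∀ y ∈ A \ Q.toSet, cubeSup 𝒟 a m y = cubeSup 𝒟₂ a m y := fun y hy => by
    refine eq_of_forall_ge_iff fun z => ?_
    rw [cubeSup_le_iff, cubeSup_le_iff]
    constructor
    · exact fun h => ⟨h.1, fun R hR => h.2 R (h2.1 hR)⟩
    · refine fun h => ⟨h.1, fun R hR hyR => ?_⟩
      rcases hcase R hR with rfl | h3 | h3
      · exact (hy.2 hyR).elim
      · exact (hy.2 ((Finset.mem_filter.1 h3).2 hyR)).elim
      · exact h.2 R h3 hyR
  have hQm := Q.measurableSet_toSet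
  obtain ⟨i1, b1⟩ := ih 𝒟₁ h1 (m ⊔ a Q) (hm.trans le_sup_left) Q.toSet hQm
    (measure_ne_top_of_subset hQA hμ) (hf.mono_set hQA) fun R hR => (Finset.mem_filter.1 hR).2
  obtain ⟨i2, b2⟩ := ih 𝒟₂ h2 m hm (A \ Q.toSet) (hA.diff hQm)
    (measure_ne_top_of_subset Set.sdiff_subset hμ) (hf.mono_set Set.sdiff_subset) fun R hR =>
      Set.subset_sdiff.2 ⟨hsub R (h2.1 hR), (Finset.mem_filter.1 hR).2⟩
  have i1' := (integrableOn_congr_fun (fun y hy => by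
    simp only [e1 y hy] : Set.EqOn (fun y => ψ (cubeSup 𝒟 a m y) (f y)) _ _) hQm).2 i1
  have i2' := (integrableOn_congr_fun (fun y hy => by
    simp only [e2 y hy] : Set.EqOn (fun y => ψ (cubeSup 𝒟 a m y) (f y)) _ _) (hA.diff hQm)).2 i2
  have hU : Q.toSet ∪ A \ Q.toSet = A := Set.union_sdiff_cancel hQA
  refine ⟨hU ▸ i1'.union i2', ?_⟩
  have hsplit := setIntegral_union (μ := μ) (Set.disjoint_sdiff_right (s := Q.toSet) (t := A))
    (hA.diff hQm) i1' i2'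
  rw [hU] at hsplit
  rw [hsplit, setIntegral_congr_fun hQm (g := fun y => ψ (cubeSup 𝒟₁ a (m ⊔ a Q) y) (f y))
    fun y hy => by simp only [e1 y hy], setIntegral_congr_fun (hA.diff hQm)
    (g := fun y => ψ (cubeSup 𝒟₂ a m y) (f y)) fun y hy => by simp only [e2 y hy]]
  refine (add_le_add b1 b2).trans (le_trans ?_
    ((hconc m hm).add_setAverage_le hQm hA hQA hμ hf))
  exact add_le_add_left (mul_le_mul_of_nonneg_left (hsup m hm _) measureReal_nonneg) _

end Burkholder

/-! ### Maximal inequalities with respect to arbitrary measures -/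

/-- A midpoint concave function that is bounded below on segments is concave. -/
theorem concaveOn_univ_of_midpoint {E : Type*} [AddCommGroup E] [Module ℝ E] {φ : E → ℝ}
    (hmid : ∀ a b, (φ a + φ b) / 2 ≤ φ ((2⁻¹ : ℝ) • (a + b)))
    (hbdd : ∀ a b, ∃ c : ℝ, ∀ t ∈ Set.Icc (0 : ℝ) 1, c ≤ φ ((1 - t) • a + t • b)) :
    ConcaveOn ℝ Set.univ φ := by
  refine ⟨convex_univ, fun a _ b _ => ?_⟩
  -- `g` is midpoint concave on `[0,1]` and vanishes at the end points, so `g ≥ (inf g) / 2`.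
  set g : ℝ → ℝ := fun t => φ ((1 - t) • a + t • b) - ((1 - t) * φ a + t * φ b) with hg
  have hg0 : g 0 = 0 := by simp [hg]
  have hg1 : g 1 = 0 := by simp [hg]
  have hgm : ∀ s t, (g s + g t) / 2 ≤ g ((s + t) / 2) := fun s t => by
    have h := hmid ((1 - s) • a + s • b) ((1 - t) • a + t • b)
    have e : (2⁻¹ : ℝ) • (((1 - s) • a + s • b) + ((1 - t) • a + t • b)) =
        (1 - (s + t) / 2) • a + ((s + t) / 2) • b := by module
    rw [e] at h
    simp only [hg]
    linarith
  obtain ⟨c, hc⟩ := hbdd a b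
  have hbd : BddBelow (g '' Set.Icc 0 1) := by
    refine ⟨c - (|φ a| + |φ b|), ?_⟩
    rintro _ ⟨t, ht, rfl⟩
    have h1 := hc t ht
    have h2 : (1 - t) * φ a ≤ |φ a| := by
      nlinarith [le_abs_self (φ a), abs_nonneg (φ a), ht.1, ht.2]
    have h3 : t * φ b ≤ |φ b| := by
      nlinarith [le_abs_self (φ b), abs_nonneg (φ b), ht.1, ht.2]
    simp only [hg]
    linarith
  set I := sInf (g '' Set.Icc 0 1)
  have hI : ∀ t ∈ Set.Icc (0 : ℝ) 1, I ≤ g t := fun t ht => csInf_le hbd ⟨t, ht, rfl⟩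
  have hI2 : I / 2 ≤ I := by
    refine le_csInf ⟨g 0, 0, by simp, rfl⟩ ?_
    rintro _ ⟨t, ht, rfl⟩
    rcases le_total t (1 / 2) with h | h
    · have h1 := hgm 0 (2 * t)
      rw [hg0, show (0 + 2 * t) / 2 = t by ring] at h1
      linarith [hI (2 * t) ⟨by linarith [ht.1], by linarith⟩]
    · have h1 := hgm 1 (2 * t - 1)
      rw [hg1, show (1 + (2 * t - 1)) / 2 = t by ring] at h1
      linarith [hI (2 * t - 1) ⟨by linarith, by linarith [ht.2]⟩]
  intro s t hs ht hst
  obtain rfl : s = 1 - t := by linarith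
  have h := hI t ⟨ht, by linarith⟩
  simp only [hg] at h
  simp only [smul_eq_mul]
  linarith

namespace MartingaleTree

variable {E : Type*} [NormedAddCommGroup E] [NormedSpace ℝ E] [Lattice E]

theorem exceed_mono {E : Type*} [NormedAddCommGroup E] [Lattice E] [HasSolidNorm E]
    [IsOrderedAddMonoid E] (t : ℝ) {m n : E} (hm : 0 ≤ m) (hmn : m ≤ n) :
    exceed t m ≤ exceed t n := by
  have h : ‖m‖ ≤ ‖n‖ := norm_le_norm_of_abs_le_abs (by
    rwa [abs_of_nonneg hm, abs_of_nonneg (hm.trans hmn)])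
  simp only [exceed]
  split_ifs with h1 h2
  · exact le_rfl
  · exact absurd (h1.trans_le h) h2
  · exact zero_le_one
  · exact le_rfl

theorem supAvg_mono [HasSolidNorm E] [IsOrderedAddMonoid E] (t : ℝ) :
    ∀ (T : MartingaleTree E) {m n : E}, 0 ≤ m → m ≤ n →
      T.supAvg (exceed t) m ≤ T.supAvg (exceed t) n
  | leaf x, m, n, hm, hmn => exceed_mono t (hm.trans le_sup_left) (sup_le_sup_right hmn x)
  | node l r, m, n, hm, hmn => by
    have := supAvg_mono t l (hm.trans le_sup_left) (sup_le_sup_right hmn (node l r).mean)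
    have := supAvg_mono t r (hm.trans le_sup_left) (sup_le_sup_right hmn (node l r).mean)
    simp only [supAvg]
    linarith

/-- The Burkholder function of the weak-type inequality with constant `c` at height `t`: the best
value of `P(‖sup‖ > t) - c * E ‖·‖` over all finite dyadic martingales that start at `x`, the
running supremum being started at `m`.  -/
noncomputable def burkholder (t c : ℝ) (m x : E) : ℝ :=
  sSup ((fun T : MartingaleTree E => T.supAvg (exceed t) m - c * T.leafAvg norm) ''
    {T | T.mean = x})

variable {t c : ℝ}

theorem le_burkholder (hc : 0 ≤ c) (m : E) (T : MartingaleTree E) :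
    T.supAvg (exceed t) m - c * T.leafAvg norm ≤ burkholder t c m T.mean := by
  refine le_csSup ⟨1, ?_⟩ ⟨T, rfl, rfl⟩
  rintro _ ⟨T, -, rfl⟩
  have h1 := supAvg_le (exceed_le_one t) m T
  have h2 := mul_nonneg hc (leafAvg_norm_nonneg T)
  simp only
  linarith

theorem burkholder_le {m x : E} {b : ℝ}
    (h : ∀ T : MartingaleTree E, T.mean = x → T.supAvg (exceed t) m - c * T.leafAvg norm ≤ b) :
    burkholder t c m x ≤ b := by
  refine csSup_le ⟨_, leaf x, rfl, rfl⟩ ?_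
  rintro _ ⟨T, hT, rfl⟩
  exact h T hT

theorem burkholder_sup (hc : 0 ≤ c) (m x : E) : burkholder t c (m ⊔ x) x ≤ burkholder t c m x := by
  refine burkholder_le fun T hT => ?_
  subst hT
  rw [supAvg_sup_mean]
  exact le_burkholder hc m T

variable [HasSolidNorm E] [IsOrderedAddMonoid E]

/-- Two martingales that start at `a` and `b` can be joined to one that starts at their midpoint;
hence the Burkholder function is midpoint concave, and therefore concave. -/
theorem concaveOn_burkholder (hc : 0 ≤ c) {m : E} (hm : 0 ≤ m) :
    ConcaveOn ℝ Set.univ (burkholder t c m) := by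
  refine concaveOn_univ_of_midpoint (fun a b => ?_) fun a b => ⟨-(c * (‖a‖ + ‖b‖)), fun s hs => ?_⟩
  · have key : ∀ T₁ T₂ : MartingaleTree E, T₁.mean = a → T₂.mean = b →
        (T₁.supAvg (exceed t) m - c * T₁.leafAvg norm) +
          (T₂.supAvg (exceed t) m - c * T₂.leafAvg norm) ≤
        2 * burkholder t c m ((2⁻¹ : ℝ) • (a + b)) := by
      rintro T₁ T₂ rfl rfl
      have h := le_burkholder (t := t) hc m (node T₁ T₂)
      have h1 := supAvg_mono t T₁ hm (le_sup_left (a := m) (b := (node T₁ T₂).mean))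
      have h2 := supAvg_mono t T₂ hm (le_sup_left (a := m) (b := (node T₁ T₂).mean))
      simp only [supAvg, leafAvg] at h
      change _ ≤ 2 * burkholder t c m (node T₁ T₂).mean
      linarith
    have h1 : burkholder t c m a ≤
        2 * burkholder t c m ((2⁻¹ : ℝ) • (a + b)) - burkholder t c m b := by
      refine burkholder_le fun T₁ hT₁ => ?_
      rw [le_sub_comm]
      refine burkholder_le fun T₂ hT₂ => ?_
      linarith [key T₁ T₂ hT₁ hT₂]
    linarith
  · have h := le_burkholder (t := t) hc m (leaf ((1 - s) • a + s • b))
    have h1 := exceed_nonneg t (m ⊔ ((1 - s) • a + s • b))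
    have h2 : ‖(1 - s) • a + s • b‖ ≤ ‖a‖ + ‖b‖ := by
      refine (norm_add_le _ _).trans (add_le_add ?_ ?_)
      · rw [norm_smul, Real.norm_of_nonneg (by linarith [hs.2])]
        exact mul_le_of_le_one_left (norm_nonneg a) (by linarith [hs.1])
      · rw [norm_smul, Real.norm_of_nonneg hs.1]
        exact mul_le_of_le_one_left (norm_nonneg b) hs.2
    have h3 := mul_le_mul_of_nonneg_left h2 hc
    simp only [supAvg, leafAvg, mean] at h
    linarith

end MartingaleTree

/-- The weak-type `(1,1)` inequality with constant `W` for the lattice maximal operators on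
`E`-valued functions with respect to the measure `μ`.  The supremum includes `0`, so that it makes
sense at points that lie in no cube of the family. -/
def LatticeWeakType {d : ℕ} (E : Type*) [NormedAddCommGroup E] [NormedSpace ℝ E] [Lattice E]
    (μ : Measure (Fin d → ℝ)) (W : ℝ) : Prop :=
  ∀ (A : Set (Fin d → ℝ)) (f : (Fin d → ℝ) → E) (𝒟 : Finset (DyadicCube d)) (t : ℝ), 0 < t →
    MeasurableSet A → μ A ≠ ∞ → IntegrableOn f A μ → (∀ Q ∈ 𝒟, Q.toSet ⊆ A) →
      t * μ.real {y ∈ A | t < ‖cubeSup 𝒟 (fun Q => ⨍ z in Q.toSet, f z ∂μ) 0 y‖} ≤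
        W * ∫ y in A, ‖f y‖ ∂μ

open MartingaleTree in
/-- The weak-type `(1,1)` inequality for the lattice maximal operator with respect to an arbitrary
measure. -/
theorem HasHardyLittlewoodProperty.exists_weakType {E : Type*} [NormedAddCommGroup E]
    [NormedSpace ℝ E] [CompleteSpace E] [Lattice E] [HasSolidNorm E] [IsOrderedAddMonoid E]
    {d : ℕ} (hd : 0 < d) (h : HasHardyLittlewoodProperty d E) :
    ∃ W : ℝ, 1 ≤ W ∧ ∀ μ : Measure (Fin d → ℝ), LatticeWeakType E μ W := by
  obtain ⟨W, hW, hT⟩ := exists_mul_supAvg_exceed_le ⟨0, hd⟩ h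
  refine ⟨W, hW, fun μ A f 𝒟 t ht hA hμ hf hsub => ?_⟩
  have hc : 0 ≤ W / t := by positivity
  have hbase : ∀ m : E, 0 ≤ m → ∀ B, MeasurableSet B → μ B ≠ ∞ → IntegrableOn f B μ →
      IntegrableOn (fun y => exceed t m - W / t * ‖f y‖) B μ ∧
        ∫ y in B, (exceed t m - W / t * ‖f y‖) ∂μ ≤
          μ.real B * burkholder t (W / t) m (⨍ y in B, f y ∂μ) := by
    intro m hm B hB hμB hfB
    have i1 : IntegrableOn (fun _ => exceed t m) B μ := integrableOn_const hμB
    have i2 : IntegrableOn (fun y => W / t * ‖f y‖) B μ := hfB.norm.const_mul _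
    refine ⟨i1.sub i2, ?_⟩
    rw [integral_sub i1 i2, setIntegral_const, integral_const_mul, smul_eq_mul]
    have h1 := le_burkholder (t := t) hc m (leaf (⨍ y in B, f y ∂μ))
    have h2 : exceed t m ≤ exceed t (m ⊔ ⨍ y in B, f y ∂μ) :=
      exceed_mono t hm le_sup_left
    have h3 := mul_le_mul_of_nonneg_left (h1.trans' (sub_le_sub_right h2 _))
      (measureReal_nonneg (μ := μ) (s := B))
    have h4 : μ.real B * ‖⨍ y in B, f y ∂μ‖ ≤ ∫ y in B, ‖f y‖ ∂μ := by
      have e := measureReal_smul_setAverage hμB f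
      have h5 := norm_integral_le_integral_norm (μ := μ.restrict B) f
      rwa [← e, norm_smul, Real.norm_of_nonneg measureReal_nonneg] at h5
    have h5 := mul_le_mul_of_nonneg_left h4 hc
    simp only [leafAvg, mean] at h3
    linarith
  obtain ⟨hi, hle⟩ := setIntegral_cubeSup_le (ψ := fun m x => exceed t m - W / t * ‖x‖)
    (fun m hm => concaveOn_burkholder (t := t) hc hm) (fun m _ => burkholder_sup hc m) hbase 𝒟 0
    le_rfl A hA hμ hf hsub
  have hV : burkholder t (W / t) 0 (⨍ y in A, f y ∂μ) ≤ 0 := burkholder_le fun T _ => by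
    have := hT t ht T
    rw [sub_nonpos, div_mul_eq_mul_div, le_div_iff₀ ht]
    linarith
  have h0 := hle.trans (mul_nonpos_of_nonneg_of_nonpos measureReal_nonneg hV)
  set M := cubeSup 𝒟 (fun Q => ⨍ z in Q.toSet, f z ∂μ) 0
  have hfi : IntegrableOn (fun y => W / t * ‖f y‖) A μ := hf.norm.const_mul _
  have hMi : IntegrableOn (fun y => exceed t (M y)) A μ := by
    refine (hi.add hfi).congr (Filter.Eventually.of_forall fun y => ?_)
    simp
  rw [integral_sub hMi hfi, integral_const_mul] at h0
  have hS : MeasurableSet {y | t < ‖M y‖} :=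
    (stronglyMeasurable_cubeSup _ _ _).norm.measurable measurableSet_Ioi
  have hM : ∫ y in A, exceed t (M y) ∂μ = μ.real {y ∈ A | t < ‖M y‖} := by
    have : (fun y => exceed t (M y)) = {y | t < ‖M y‖}.indicator 1 := by
      funext y
      simp [exceed, Set.indicator_apply]
    rw [this, integral_indicator_one hS, measureReal_restrict_apply hS, Set.inter_comm]
    rfl
  rw [hM] at h0
  have h1 := mul_le_mul_of_nonneg_left (sub_nonpos.1 h0) ht.le
  refine h1.trans_eq ?_
  field_simp

/-- **Doob's maximal inequality** for finite families of dyadic cubes. -/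
theorem lintegral_cubeSup_rpow_le {F : Type*} [NormedAddCommGroup F] {d : ℕ}
    {μ : Measure (Fin d → ℝ)} [IsLocallyFiniteMeasure μ] {q : ℝ} (hq : 1 < q)
    {f : (Fin d → ℝ) → F} (hf : MemLp f (ENNReal.ofReal q) μ) (𝒟 : Finset (DyadicCube d)) :
    ∫⁻ y, ENNReal.ofReal (cubeSup 𝒟 (fun Q => ⨍ z in Q.toSet, ‖f z‖ ∂μ) 0 y) ^ q ∂μ ≤
      ENNReal.ofReal ((q / (q - 1)) ^ q) * ∫⁻ y, ‖f y‖ₑ ^ q ∂μ := by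
  set M := cubeSup 𝒟 (fun Q => ⨍ z in Q.toSet, ‖f z‖ ∂μ) (0 : ℝ) with hMdef
  have hq0 : 0 < q := by linarith
  have hq1 : 0 < q - 1 := by linarith
  have hpq : (q / (q - 1)).HolderConjugate q := (Real.HolderConjugate.conjExponent hq).symm
  set c := q / (q - 1) with hc
  have hc0 : 0 < c := by positivity
  have hM0 : ∀ y, 0 ≤ M y := fun y => le_cubeSup
  set A : Set (Fin d → ℝ) := ⋃ Q ∈ 𝒟, Q.toSet with hAdef
  have hA : MeasurableSet A := 𝒟.measurableSet_biUnion fun Q _ => Q.measurableSet_toSet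
  have hμ : μ A ≠ ∞ :=
    (measure_biUnion_lt_top 𝒟.finite_toSet fun Q _ => Q.measure_toSet_lt_top μ).ne
  have : IsFiniteMeasure (μ.restrict A) := ⟨by simpa using hμ.lt_top⟩
  have hfA : IntegrableOn f A μ :=
    (hf.restrict A).integrable (by rw [← ENNReal.ofReal_one]; exact ENNReal.ofReal_le_ofReal hq.le)
  have hfq : IntegrableOn (fun y => ‖f y‖ ^ q) A μ := by
    have := (hf.restrict A).integrable_norm_rpow (by simpa using hq0) ENNReal.ofReal_ne_top
    rwa [ENNReal.toReal_ofReal hq0.le] at this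
  have young : ∀ m x : ℝ, 0 ≤ m → 0 ≤ x → m ^ (q - 1) * x ≤ m ^ q / c + x ^ q / q := by
    intro m x hm hx
    have h := Real.young_inequality_of_nonneg (Real.rpow_nonneg hm (q - 1)) hx hpq
    rwa [← Real.rpow_mul hm, show (q - 1) * c = q by rw [hc]; field_simp] at h
  obtain ⟨hi, hle⟩ := setIntegral_cubeSup_le (μ := μ) (f := fun y => ‖f y‖) (m₀ := 0)
    (V := fun m x => m ^ q - c * m ^ (q - 1) * x) (ψ := fun m x => m ^ q - c * m ^ (q - 1) * x)
    (fun m _ => by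
      refine ⟨convex_univ, fun x _ y _ s t _ _ hst => ?_⟩
      simp only [smul_eq_mul]
      have : m ^ q = (s + t) * m ^ q := by rw [hst, one_mul]
      linarith)
    (fun m hm x => by
      rcases le_total x m with h | h
      · rw [sup_eq_left.2 h]
      · have hx := hm.trans h
        rw [sup_eq_right.2 h]
        have e : x ^ (q - 1) * x = x ^ q := by
          rw [← Real.rpow_add_one' hx (by linarith)]; simp
        have h1 := mul_le_mul_of_nonneg_left (young m x hm hx) hc0.le
        have e1 : c * (m ^ q / c + x ^ q / q) = m ^ q + (c - 1) * x ^ q := by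
          have : c / q = c - 1 := by rw [hc]; field_simp; ring
          rw [mul_add, mul_div_cancel₀ _ hc0.ne', mul_div_assoc', mul_div_right_comm, this]
        rw [e1] at h1
        rw [mul_assoc, e]
        linarith)
    (fun m _ B _ hμB hfB => by
      have i1 : IntegrableOn (fun _ => m ^ q) B μ := integrableOn_const hμB
      have i2 : IntegrableOn (fun y => c * m ^ (q - 1) * ‖f y‖) B μ := hfB.const_mul _
      refine ⟨i1.sub i2, le_of_eq ?_⟩
      rw [integral_sub i1 i2, setIntegral_const, integral_const_mul,
        ← measureReal_smul_setAverage hμB, smul_eq_mul, smul_eq_mul]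
      ring) 𝒟 0 le_rfl A hA hμ hfA.norm fun Q hQ =>
        Set.subset_biUnion_of_mem (u := fun Q => Q.toSet) hQ
  rw [Real.zero_rpow hq0.ne', Real.zero_rpow hq1.ne', mul_zero, zero_mul, sub_zero, mul_zero] at hle
  have hpt : ∀ y, M y ^ q ≤ q * (M y ^ q - c * M y ^ (q - 1) * ‖f y‖) + c ^ q * ‖f y‖ ^ q := by
    intro y
    have h := young (M y) (c * ‖f y‖) (hM0 y) (by positivity)
    rw [Real.mul_rpow hc0.le (norm_nonneg _)] at h
    have h1 := mul_le_mul_of_nonneg_left h hq0.le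
    have e1 : q * (M y ^ q / c + c ^ q * ‖f y‖ ^ q / q) =
        (q - 1) * M y ^ q + c ^ q * ‖f y‖ ^ q := by
      have : q / c = q - 1 := by rw [hc]; field_simp
      rw [mul_add, mul_div_assoc', mul_div_cancel₀ _ hq0.ne', mul_div_right_comm, this]
    rw [e1] at h1
    linarith
  have hR : IntegrableOn
    (fun y => q * (M y ^ q - c * M y ^ (q - 1) * ‖f y‖) + c ^ q * ‖f y‖ ^ q) A μ :=
    (hi.const_mul q).add (hfq.const_mul _)
  have hmain : ∫ y in A, (q * (M y ^ q - c * M y ^ (q - 1) * ‖f y‖) + c ^ q * ‖f y‖ ^ q) ∂μ ≤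
      c ^ q * ∫ y in A, ‖f y‖ ^ q ∂μ := by
    rw [integral_add (hi.const_mul q) (hfq.const_mul _), integral_const_mul, integral_const_mul]
    have := mul_nonpos_of_nonneg_of_nonpos hq0.le hle
    linarith
  calc ∫⁻ y, ENNReal.ofReal (M y) ^ q ∂μ = ∫⁻ y in A, ENNReal.ofReal (M y) ^ q ∂μ := by
        rw [← lintegral_indicator hA]
        refine lintegral_congr fun y => ?_
        by_cases hy : y ∈ A
        · rw [Set.indicator_of_mem hy]
        · rw [Set.indicator_of_notMem hy, hMdef, cubeSup_of_forall_notMem, ENNReal.ofReal_zero,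
            ENNReal.zero_rpow_of_pos hq0]
          exact fun Q hQ hyQ => hy (Set.mem_biUnion hQ hyQ)
    _ ≤ ∫⁻ y in A, ENNReal.ofReal
          (q * (M y ^ q - c * M y ^ (q - 1) * ‖f y‖) + c ^ q * ‖f y‖ ^ q) ∂μ := by
        refine lintegral_mono fun y => ?_
        rw [ENNReal.ofReal_rpow_of_nonneg (hM0 y) hq0.le]
        exact ENNReal.ofReal_le_ofReal (hpt y)
    _ = ENNReal.ofReal (∫ y in A,
          (q * (M y ^ q - c * M y ^ (q - 1) * ‖f y‖) + c ^ q * ‖f y‖ ^ q) ∂μ) :=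
        (ofReal_integral_eq_lintegral_ofReal hR (Filter.Eventually.of_forall fun y =>
          (Real.rpow_nonneg (hM0 y) q).trans (hpt y))).symm
    _ ≤ ENNReal.ofReal (c ^ q * ∫ y in A, ‖f y‖ ^ q ∂μ) := ENNReal.ofReal_le_ofReal hmain
    _ = ENNReal.ofReal (c ^ q) * ∫⁻ y in A, ‖f y‖ₑ ^ q ∂μ := by
        rw [ENNReal.ofReal_mul (by positivity), ofReal_integral_eq_lintegral_ofReal hfq
          (Filter.Eventually.of_forall fun y => by positivity)]
        simp only [ofReal_norm_rpow _ hq0.le]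
    _ ≤ _ := by
        gcongr
        exact Measure.restrict_le_self

/-! ### Sparse domination of the bilinear form -/

namespace LatticeDual

/-- Evaluation at a vector, as a continuous linear functional on the dual. -/
noncomputable def evalCLM {E : Type*} [NormedAddCommGroup E] [NormedSpace ℝ E] (x : E) :
    LatticeDual E →L[ℝ] ℝ :=
  LinearMap.mkContinuous
    { toFun := fun φ => φ x
      map_add' := fun φ ψ => add_apply φ ψ x
      map_smul' := fun r φ => smul_apply r φ x } ‖x‖
    fun φ => by
      rw [mul_comm]
      exact abs_apply_le φ x

end LatticeDual

theorem LinearMap.apply_le_apply_of_nonneg {C D : Type*} [AddCommGroup C] [Module ℝ C]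
    [PartialOrder C] [IsOrderedAddMonoid C] [AddCommGroup D] [Module ℝ D] [PartialOrder D]
    [IsOrderedAddMonoid D] {T : C →ₗ[ℝ] D} (hT : ∀ c, 0 ≤ c → 0 ≤ T c) {x y : C}
    (h : x ≤ y) : T x ≤ T y := by
  have := hT (y - x) (sub_nonneg.2 h)
  rwa [map_sub, sub_nonneg] at this

/-- The averages over the cubes of a family that contain a given point, and are not contained in
`Ω`, have a lattice supremum that is dominated by the value of the maximal function at a point
outside `Ω`. -/
theorem exists_cubeSup_le {E : Type*} [Lattice E] {d : ℕ} {𝒟 𝒢 : Finset (DyadicCube d)} (h : 𝒢 ⊆ 𝒟)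
    {Ω : Set (Fin d → ℝ)} (hΩ : ∀ Q ∈ 𝒢, ¬Q.toSet ⊆ Ω) (a : DyadicCube d → E) (m : E)
    (y : Fin d → ℝ) :
    cubeSup 𝒢 a m y = m ∨ ∃ z ∉ Ω, cubeSup 𝒢 a m y ≤ cubeSup 𝒟 a m z := by
  classical
  rcases (𝒢.filter fun Q => y ∈ Q.toSet).eq_empty_or_nonempty with he | hne
  · refine Or.inl (cubeSup_of_forall_notMem fun Q hQ hy => ?_)
    have : Q ∈ 𝒢.filter fun Q => y ∈ Q.toSet := Finset.mem_filter.2 ⟨hQ, hy⟩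
    rw [he] at this
    exact Finset.notMem_empty _ this
  -- The smallest cube of `𝒢` that contains `y` is contained in all the others.
  obtain ⟨Q, hQ, hmax⟩ := Finset.exists_max_image _ (fun Q => Q.k) hne
  rw [Finset.mem_filter] at hQ
  obtain ⟨z, hzQ, hz⟩ := Set.not_subset.1 (hΩ Q hQ.1)
  refine Or.inr ⟨z, hz, cubeSup_le_iff.2 ⟨le_cubeSup, fun R hR hyR => ?_⟩⟩
  refine apply_le_cubeSup (h hR) ?_
  rcases DyadicCube.subset_or_disjoint (hmax R (Finset.mem_filter.2 ⟨hR, hyR⟩)) with h1 | h1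
  · exact h1 hzQ
  · exact (Set.disjoint_left.1 h1 hQ.2 hyR).elim

section Pairing

variable {C D : Type*} [NormedAddCommGroup C] [NormedSpace ℝ C]
  [NormedAddCommGroup D] [NormedSpace ℝ D] {d : ℕ} {μ : Measure (Fin d → ℝ)}

/-- The bilinear form `∫ ⟨g, T_λ(f μ)⟩ dμ = ∑_{Q ∈ 𝒟} ⟨∫_Q g dμ, λ_Q ∫_Q f dμ⟩` of the dyadic
operator. -/
noncomputable def dyadicForm (𝒟 : Finset (DyadicCube d)) (l : DyadicCube d → C →ₗ[ℝ] D)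
    (μ : Measure (Fin d → ℝ)) (f : (Fin d → ℝ) → C) (g : (Fin d → ℝ) → LatticeDual D) : ℝ :=
  ∑ Q ∈ 𝒟, (∫ y in Q.toSet, g y ∂μ) (l Q (∫ y in Q.toSet, f y ∂μ))

theorem dyadicForm_eq_integral {𝒟 : Finset (DyadicCube d)} (l : DyadicCube d → C →ₗ[ℝ] D)
    (f : (Fin d → ℝ) → C) {g : (Fin d → ℝ) → LatticeDual D}
    (hg : ∀ Q ∈ 𝒟, IntegrableOn g Q.toSet μ) :
    dyadicForm 𝒟 l μ f g = ∫ y, g y (dyadicOperator 𝒟 l μ f y) ∂μ := by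
  have h : ∀ y, g y (dyadicOperator 𝒟 l μ f y) = ∑ Q ∈ 𝒟, Q.toSet.indicator
      (fun y => g y (l Q (∫ y in Q.toSet, f y ∂μ))) y := fun y => by
    refine (map_sum (LatticeDual.toCLM (g y)) _ _).trans (Finset.sum_congr rfl fun Q _ => ?_)
    by_cases hy : y ∈ Q.toSet
    · simp only [Set.indicator_of_mem hy]
    · simp only [Set.indicator_of_notMem hy, map_zero]
  simp only [h]
  rw [integral_finsetSum]
  · refine Finset.sum_congr rfl fun Q hQ => ?_
    rw [integral_indicator Q.measurableSet_toSet]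
    exact ((LatticeDual.evalCLM _).integral_comp_comm (hg Q hQ)).symm
  · intro Q hQ
    rw [integrable_indicator_iff Q.measurableSet_toSet]
    exact (LatticeDual.evalCLM _).integrable_comp (hg Q hQ)

theorem stronglyMeasurable_dyadicOperator (𝒟 : Finset (DyadicCube d))
    (l : DyadicCube d → C →ₗ[ℝ] D) (f : (Fin d → ℝ) → C) :
    StronglyMeasurable (dyadicOperator 𝒟 l μ f) :=
  Finset.stronglyMeasurable_fun_sum _ fun Q _ =>
    stronglyMeasurable_const.indicator Q.measurableSet_toSet

theorem ofReal_dyadicForm_le {𝒟 : Finset (DyadicCube d)} (l : DyadicCube d → C →ₗ[ℝ] D)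
    (f : (Fin d → ℝ) → C) {g : (Fin d → ℝ) → LatticeDual D}
    (hg : ∀ Q ∈ 𝒟, IntegrableOn g Q.toSet μ) :
    ENNReal.ofReal (dyadicForm 𝒟 l μ f g) ≤
      ∫⁻ y, ‖g y‖ₑ * ‖dyadicOperator 𝒟 l μ f y‖ₑ ∂μ := by
  rw [dyadicForm_eq_integral l f hg]
  refine (Real.ofReal_le_enorm _).trans ((enorm_integral_le_lintegral_enorm _).trans
    (lintegral_mono fun y => ?_))
  rw [← ofReal_norm, ← ofReal_norm, ← ofReal_norm, ← ENNReal.ofReal_mul (norm_nonneg _)]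
  exact ENNReal.ofReal_le_ofReal (LatticeDual.abs_apply_le _ _)

variable [Lattice C] [HasSolidNorm C] [IsOrderedAddMonoid C] [IsOrderedModule ℝ C]
  [Lattice D] [HasSolidNorm D] [IsOrderedAddMonoid D]
  {l : DyadicCube d → C →ₗ[ℝ] D}

theorem norm_dyadicOperator_mono {𝒟 𝒟₀ : Finset (DyadicCube d)} (h : 𝒟 ⊆ 𝒟₀)
    (hl : ∀ Q ∈ 𝒟₀, ∀ c : C, 0 ≤ c → 0 ≤ l Q c) {f : (Fin d → ℝ) → C} (hf : ∀ y, 0 ≤ f y)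
    (y : Fin d → ℝ) : ‖dyadicOperator 𝒟 l μ f y‖ ≤ ‖dyadicOperator 𝒟₀ l μ f y‖ := by
  have h0 : ∀ Q ∈ 𝒟₀, 0 ≤ Q.toSet.indicator (fun _ => l Q (∫ y in Q.toSet, f y ∂μ)) y :=
    fun Q hQ => Set.indicator_nonneg (fun _ _ => hl Q hQ _ (integral_nonneg hf)) y
  exact LatticeDual.norm_le_of_nonneg_of_le (Finset.sum_nonneg fun Q hQ => h0 Q (h hQ))
    (Finset.sum_le_sum_of_subset_of_nonneg h fun Q hQ _ => h0 Q hQ)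

/-- The `L^p` bound of the operator, tested on bounded functions with bounded support.  The
exponent `p` cancels. -/
theorem DyadicOperatorBound.dyadicForm_le {𝒟 𝒟₀ : Finset (DyadicCube d)} {p : ℝ≥0∞} {A : ℝ≥0}
    (hT : DyadicOperatorBound 𝒟₀ l μ p A) (hp1 : 1 < p) (hp : p < ∞) (h : 𝒟 ⊆ 𝒟₀)
    (hl : ∀ Q ∈ 𝒟₀, ∀ c : C, 0 ≤ c → 0 ≤ l Q c) {S : Set (Fin d → ℝ)} (hS : MeasurableSet S)
    (hμ : μ S ≠ ∞) {f : (Fin d → ℝ) → C} {g : (Fin d → ℝ) → LatticeDual D} {a b : ℝ}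
    (hfm : StronglyMeasurable f) (hgm : StronglyMeasurable g)
    (hf : ∀ y, 0 ≤ f y) (hfa : ∀ y, ‖f y‖ ≤ a) (hgb : ∀ y, ‖g y‖ ≤ b)
    (hfS : ∀ y ∉ S, f y = 0) (hgS : ∀ y ∉ S, g y = 0) (h𝒟 : ∀ Q ∈ 𝒟, Q.toSet ⊆ S) :
    ENNReal.ofReal (dyadicForm 𝒟 l μ f g) ≤
      A * ENNReal.ofReal a * ENNReal.ofReal b * μ S := by
  have hp0 : p ≠ 0 := (zero_lt_one.trans hp1).ne'
  have hr : 1 < p.toReal := by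
    rw [← ENNReal.toReal_one]
    exact (ENNReal.toReal_lt_toReal ENNReal.one_ne_top hp.ne).2 hp1
  have hr0 : 0 < p.toReal := zero_lt_one.trans hr
  have : IsFiniteMeasure (μ.restrict S) := ⟨by simpa using hμ.lt_top⟩
  have hgi : ∀ Q ∈ 𝒟, IntegrableOn g Q.toSet μ := fun Q hQ =>
    IntegrableOn.mono_set (Integrable.of_bound (μ := μ.restrict S) hgm.aestronglyMeasurable b
      (Filter.Eventually.of_forall hgb)) (h𝒟 Q hQ)
  have hfind : S.indicator f = f := Set.indicator_eq_self.2 fun y hy => by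
    by_contra hyS
    exact hy (hfS y hyS)
  have hfnorm : eLpNorm f p μ ≤ μ S ^ p.toReal⁻¹ * ENNReal.ofReal a := by
    rw [← hfind, eLpNorm_indicator_eq_eLpNorm_restrict hS]
    refine (eLpNorm_le_of_ae_bound (Filter.Eventually.of_forall hfa)).trans_eq ?_
    rw [Measure.restrict_apply_univ]
  have hfmem : MemLp f p μ := ⟨hfm.aestronglyMeasurable, hfnorm.trans_lt
    (ENNReal.mul_lt_top (ENNReal.rpow_lt_top_of_nonneg (by positivity) hμ) ENNReal.ofReal_lt_top)⟩
  set F := dyadicOperator 𝒟₀ l μ f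
  have hF : ∫⁻ y in S, ‖F y‖ₑ ∂μ ≤ A * ENNReal.ofReal a * μ S := by
    rw [← eLpNorm_one_eq_lintegral_enorm]
    refine (eLpNorm_le_eLpNorm_mul_rpow_measure_univ hp1.le
      (stronglyMeasurable_dyadicOperator 𝒟₀ l f).aestronglyMeasurable).trans ?_
    rw [Measure.restrict_apply_univ]
    have e : μ S ^ p.toReal⁻¹ * μ S ^ (1 / ENNReal.toReal 1 - 1 / p.toReal) = μ S := by
      rw [← ENNReal.rpow_add_of_nonneg _ _ (by positivity) ?_]
      · simp
      · rw [ENNReal.toReal_one, div_one, sub_nonneg, div_le_one hr0]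
        exact hr.le
    calc _ ≤ eLpNorm F p μ * μ S ^ (1 / ENNReal.toReal 1 - 1 / p.toReal) := by
          gcongr
          exact Measure.restrict_le_self
      _ ≤ (A * (μ S ^ p.toReal⁻¹ * ENNReal.ofReal a)) *
            μ S ^ (1 / ENNReal.toReal 1 - 1 / p.toReal) := by
          gcongr
          exact (hT f hfmem).trans (by gcongr)
      _ = A * ENNReal.ofReal a *
            (μ S ^ p.toReal⁻¹ * μ S ^ (1 / ENNReal.toReal 1 - 1 / p.toReal)) := by ring
      _ = _ := by rw [e]
  calc ENNReal.ofReal (dyadicForm 𝒟 l μ f g)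
      ≤ ∫⁻ y, ‖g y‖ₑ * ‖dyadicOperator 𝒟 l μ f y‖ₑ ∂μ := ofReal_dyadicForm_le l f hgi
    _ ≤ ∫⁻ y, S.indicator (fun y => ENNReal.ofReal b * ‖F y‖ₑ) y ∂μ := by
        refine lintegral_mono fun y => ?_
        by_cases hy : y ∈ S
        · simp only [Set.indicator_of_mem hy]
          rw [← ofReal_norm (g y), ← ofReal_norm (F y), ← ofReal_norm]
          have h1 := norm_dyadicOperator_mono (μ := μ) h hl hf y
          have h2 := hgb y
          gcongr
        · simp [Set.indicator_of_notMem hy, hgS y hy]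
    _ = ENNReal.ofReal b * ∫⁻ y in S, ‖F y‖ₑ ∂μ := by
        rw [lintegral_indicator hS, lintegral_const_mul' _ _ ENNReal.ofReal_ne_top]
    _ ≤ ENNReal.ofReal b * (A * ENNReal.ofReal a * μ S) := by gcongr
    _ = _ := by ring

end Pairing

section Sparse

variable {d : ℕ} {μ : Measure (Fin d → ℝ)}

theorem LatticeWeakType.measureReal_le {E : Type*} [NormedAddCommGroup E] [NormedSpace ℝ E]
    [Lattice E] {W : ℝ} (hE : LatticeWeakType E μ W) (hW : 0 < W) {S : Set (Fin d → ℝ)}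
    {f : (Fin d → ℝ) → E} {𝒟 : Finset (DyadicCube d)} (hS : MeasurableSet S) (hμ : μ S ≠ ∞)
    (hf : IntegrableOn f S μ) (h𝒟 : ∀ Q ∈ 𝒟, Q.toSet ⊆ S) (hF : 0 < ⨍ y in S, ‖f y‖ ∂μ) :
    μ.real {y ∈ S | 4 * W * ⨍ y in S, ‖f y‖ ∂μ <
      ‖cubeSup 𝒟 (fun Q => ⨍ z in Q.toSet, f z ∂μ) 0 y‖} ≤ μ.real S / 4 := by
  have h := hE S f 𝒟 (4 * W * ⨍ y in S, ‖f y‖ ∂μ) (by positivity) hS hμ hf h𝒟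
  rw [← measureReal_smul_setAverage hμ, smul_eq_mul] at h
  set F := ⨍ y in S, ‖f y‖ ∂μ
  have h' : (W * F) * (4 * μ.real {y ∈ S | 4 * W * F <
      ‖cubeSup 𝒟 (fun Q => ⨍ z in Q.toSet, f z ∂μ) 0 y‖}) ≤ (W * F) * μ.real S := by
    linarith
  have := le_of_mul_le_mul_left h' (by positivity)
  linarith

theorem setAverage_norm_nonneg {E : Type*} [NormedAddCommGroup E] (S : Set (Fin d → ℝ))
    (u : (Fin d → ℝ) → E) : 0 ≤ ⨍ y in S, ‖u y‖ ∂μ := by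
  rw [setAverage_eq]
  exact smul_nonneg (by positivity) (integral_nonneg fun y => norm_nonneg _)

theorem setIntegral_eq_zero_of_average_norm_eq_zero {E : Type*} [NormedAddCommGroup E]
    [NormedSpace ℝ E] {S T : Set (Fin d → ℝ)} {u : (Fin d → ℝ) → E} (hμ : μ S ≠ ∞)
    (hu : IntegrableOn u S μ) (h0 : ⨍ y in S, ‖u y‖ ∂μ = 0) (hT : T ⊆ S) :
    ∫ y in T, u y ∂μ = 0 := by
  rw [← norm_le_zero_iff]
  refine (norm_integral_le_integral_norm _).trans ((setIntegral_mono_set hu.norm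
    (Filter.Eventually.of_forall fun y => norm_nonneg _) hT.eventuallyLE).trans_eq ?_)
  rw [← measureReal_smul_setAverage hμ, h0, smul_zero]

theorem norm_cubeSup_le_of_forall_notMem {E : Type*} [NormedAddCommGroup E] [Lattice E]
    [HasSolidNorm E] [IsOrderedAddMonoid E] {𝒟 𝒢 : Finset (DyadicCube d)} (h : 𝒢 ⊆ 𝒟)
    {Ω : Set (Fin d → ℝ)} (hΩ : ∀ Q ∈ 𝒢, ¬Q.toSet ⊆ Ω) {a : DyadicCube d → E} {r : ℝ}
    (hr0 : 0 ≤ r) (hr : ∀ y ∉ Ω, ‖cubeSup 𝒟 a 0 y‖ ≤ r) (y : Fin d → ℝ) :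
    ‖cubeSup 𝒢 a 0 y‖ ≤ r := by
  rcases exists_cubeSup_le h hΩ a 0 y with h | ⟨z, hz, h⟩
  · rwa [h, norm_zero]
  · refine le_trans (norm_le_norm_of_abs_le_abs ?_) (hr z hz)
    rwa [abs_of_nonneg le_cubeSup, abs_of_nonneg le_cubeSup]

variable {C D : Type*} [NormedAddCommGroup C] [NormedSpace ℝ C] [CompleteSpace C] [Lattice C]
  [HasSolidNorm C] [IsOrderedAddMonoid C] [IsOrderedModule ℝ C]
  [NormedAddCommGroup D] [NormedSpace ℝ D] [Lattice D] [HasSolidNorm D] [IsOrderedAddMonoid D]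
  {l : DyadicCube d → C →ₗ[ℝ] D}

theorem setIntegral_le_setIntegral_cubeSup {E : Type*} [NormedAddCommGroup E] [NormedSpace ℝ E]
    [CompleteSpace E] [Lattice E] [HasSolidNorm E] [IsOrderedAddMonoid E] [IsOrderedModule ℝ E]
    {f : (Fin d → ℝ) → E} {𝒟 : Finset (DyadicCube d)} {Q : DyadicCube d} (hQ : Q ∈ 𝒟)
    (hμ : μ Q.toSet ≠ ∞)
    (hi : IntegrableOn (cubeSup 𝒟 (fun Q => ⨍ z in Q.toSet, f z ∂μ) 0) Q.toSet μ) :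
    ∫ y in Q.toSet, f y ∂μ ≤
      ∫ y in Q.toSet, cubeSup 𝒟 (fun Q => ⨍ z in Q.toSet, f z ∂μ) 0 y ∂μ := by
  rw [← measureReal_smul_setAverage hμ, ← setIntegral_const]
  exact setIntegral_mono_on (integrableOn_const hμ) hi Q.measurableSet_toSet fun y hy =>
    apply_le_cubeSup (a := fun Q => ⨍ z in Q.toSet, f z ∂μ) hQ hy

theorem dyadicForm_eq_zero {C D : Type*} [NormedAddCommGroup C] [NormedSpace ℝ C]
    [NormedAddCommGroup D] [NormedSpace ℝ D] {l : DyadicCube d → C →ₗ[ℝ] D}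
    {𝒟 : Finset (DyadicCube d)} {f : (Fin d → ℝ) → C}
    {g : (Fin d → ℝ) → LatticeDual D} {S : Set (Fin d → ℝ)} (hμ : μ S ≠ ∞)
    (hfS : IntegrableOn f S μ) (hgS : IntegrableOn g S μ) (h𝒟 : ∀ Q ∈ 𝒟, Q.toSet ⊆ S)
    (h : ⨍ y in S, ‖f y‖ ∂μ = 0 ∨ ⨍ y in S, ‖g y‖ ∂μ = 0) :
    dyadicForm 𝒟 l μ f g = 0 := by
  refine Finset.sum_eq_zero fun Q hQ => ?_
  rcases h with h | h
  · rw [setIntegral_eq_zero_of_average_norm_eq_zero hμ hfS h (h𝒟 Q hQ), map_zero]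
    exact map_zero (LatticeDual.toCLM _)
  · rw [setIntegral_eq_zero_of_average_norm_eq_zero hμ hgS h (h𝒟 Q hQ)]
    rfl

/-- The estimate for the cubes that have not been stopped: on these, `f` and `g` can be replaced by
their lattice maximal functions, which are bounded by the stopping condition. -/
theorem DyadicOperatorBound.dyadicForm_le_average [IsLocallyFiniteMeasure μ]
    {𝒟₀ 𝒟 𝒢 : Finset (DyadicCube d)} {p : ℝ≥0∞} {A : ℝ≥0} (hT : DyadicOperatorBound 𝒟₀ l μ p A)
    (hp1 : 1 < p) (hp : p < ∞) (hl : ∀ Q ∈ 𝒟₀, ∀ c : C, 0 ≤ c → 0 ≤ l Q c) (h𝒟 : 𝒟 ⊆ 𝒟₀)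
    (h𝒢 : 𝒢 ⊆ 𝒟) {S Ω : Set (Fin d → ℝ)} (hS : MeasurableSet S) (hμ : μ S ≠ ∞)
    (hsub : ∀ Q ∈ 𝒢, Q.toSet ⊆ S) (hΩ : ∀ Q ∈ 𝒢, ¬Q.toSet ⊆ Ω)
    {f : (Fin d → ℝ) → C} {g : (Fin d → ℝ) → LatticeDual D} (hf : ∀ y, 0 ≤ f y) {a b : ℝ}
    (ha0 : 0 ≤ a) (hb0 : 0 ≤ b)
    (ha : ∀ y ∉ Ω, ‖cubeSup 𝒟 (fun Q => ⨍ z in Q.toSet, f z ∂μ) 0 y‖ ≤ a)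
    (hb : ∀ y ∉ Ω, ‖cubeSup 𝒟 (fun Q => ⨍ z in Q.toSet, g z ∂μ) 0 y‖ ≤ b) :
    ENNReal.ofReal (dyadicForm 𝒢 l μ f g) ≤ A * ENNReal.ofReal a * ENNReal.ofReal b * μ S := by
  have ha' := norm_cubeSup_le_of_forall_notMem h𝒢 hΩ ha0 ha
  have hb' := norm_cubeSup_le_of_forall_notMem h𝒢 hΩ hb0 hb
  set f' := cubeSup 𝒢 (fun Q => ⨍ z in Q.toSet, f z ∂μ) 0 with hf'
  set g' := cubeSup 𝒢 (fun Q => ⨍ z in Q.toSet, g z ∂μ) 0 with hg'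
  have hfm : StronglyMeasurable f' := stronglyMeasurable_cubeSup _ _ _
  have hgm : StronglyMeasurable g' := stronglyMeasurable_cubeSup _ _ _
  have hfin : ∀ Q : DyadicCube d, IsFiniteMeasure (μ.restrict Q.toSet) := fun Q =>
    ⟨by simpa using Q.measure_toSet_lt_top μ⟩
  have hfi : ∀ Q : DyadicCube d, IntegrableOn f' Q.toSet μ := fun Q =>
    Integrable.of_bound hfm.aestronglyMeasurable a (Filter.Eventually.of_forall ha')
  have hgi : ∀ Q : DyadicCube d, IntegrableOn g' Q.toSet μ := fun Q =>
    Integrable.of_bound hgm.aestronglyMeasurable b (Filter.Eventually.of_forall hb')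
  have hle : dyadicForm 𝒢 l μ f g ≤ dyadicForm 𝒢 l μ f' g' := by
    refine Finset.sum_le_sum fun Q hQ => ?_
    have hlQ := hl Q (h𝒟 (h𝒢 hQ))
    have hQμ := (Q.measure_toSet_lt_top μ).ne
    have h1 := LinearMap.apply_le_apply_of_nonneg hlQ
      (setIntegral_le_setIntegral_cubeSup hQ hQμ (hfi Q))
    have h2 := setIntegral_le_setIntegral_cubeSup hQ hQμ (hgi Q)
    have h0 : 0 ≤ l Q (∫ y in Q.toSet, f y ∂μ) := hlQ _ (integral_nonneg hf)
    have h3 : 0 ≤ ∫ y in Q.toSet, g' y ∂μ := integral_nonneg fun y => le_cubeSup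
    refine (h2 _ h0).trans ?_
    have h4 := h3 _ (sub_nonneg.2 h1)
    have h5 := map_sub (LatticeDual.toCLM (∫ y in Q.toSet, g' y ∂μ))
      (l Q (∫ y in Q.toSet, f' y ∂μ)) (l Q (∫ y in Q.toSet, f y ∂μ))
    have h6 : (0 : LatticeDual D) (l Q (∫ y in Q.toSet, f' y ∂μ) -
      l Q (∫ y in Q.toSet, f y ∂μ)) = 0 := rfl
    linarith
  refine (ENNReal.ofReal_le_ofReal hle).trans
    (hT.dyadicForm_le hp1 hp (h𝒢.trans h𝒟) hl hS hμ hfm hgm (fun y => le_cubeSup) ha' hb'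
      ?_ ?_ hsub)
  · exact fun y hy => cubeSup_of_forall_notMem fun Q hQ hyQ => hy (hsub Q hQ hyQ)
  · exact fun y hy => cubeSup_of_forall_notMem fun Q hQ hyQ => hy (hsub Q hQ hyQ)

/-- The product of the scalar maximal functions of `f` and `g`. -/
noncomputable def maximalProduct {E F : Type*} [NormedAddCommGroup E] [NormedAddCommGroup F]
    (𝒟 : Finset (DyadicCube d)) (μ : Measure (Fin d → ℝ)) (f : (Fin d → ℝ) → E)
    (g : (Fin d → ℝ) → F) (y : Fin d → ℝ) : ℝ≥0∞ :=
  ENNReal.ofReal (cubeSup 𝒟 (fun Q => ⨍ z in Q.toSet, ‖f z‖ ∂μ) 0 y) *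
    ENNReal.ofReal (cubeSup 𝒟 (fun Q => ⨍ z in Q.toSet, ‖g z‖ ∂μ) 0 y)

theorem maximalProduct_mono {E F : Type*} [NormedAddCommGroup E] [NormedAddCommGroup F]
    {𝒟 ℰ : Finset (DyadicCube d)} (h : ℰ ⊆ 𝒟) (f : (Fin d → ℝ) → E)
    (g : (Fin d → ℝ) → F) (y : Fin d → ℝ) :
    maximalProduct ℰ μ f g y ≤ maximalProduct 𝒟 μ f g y :=
  mul_le_mul' (ENNReal.ofReal_le_ofReal (cubeSup_mono h))
    (ENNReal.ofReal_le_ofReal (cubeSup_mono h))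

theorem maximalProduct_eq_zero {E F : Type*} [NormedAddCommGroup E] [NormedAddCommGroup F]
    {𝒟 : Finset (DyadicCube d)} (f : (Fin d → ℝ) → E)
    (g : (Fin d → ℝ) → F) {y : Fin d → ℝ} (h : ∀ Q ∈ 𝒟, y ∉ Q.toSet) :
    maximalProduct 𝒟 μ f g y = 0 := by
  rw [maximalProduct, cubeSup_of_forall_notMem h, ENNReal.ofReal_zero, zero_mul]

theorem measure_le_two_mul_measure_diff {α : Type*} [MeasurableSpace α] {μ : Measure α}
    {S U : Set α} (hU : MeasurableSet U) (hμ : μ S ≠ ∞) (h : μ.real (S ∩ U) ≤ μ.real S / 2) :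
    μ S ≤ 2 * μ (S \ U) := by
  have h2 := measureReal_inter_add_sdiff (μ := μ) (s := S) hU hμ
  have h3 : μ.real S ≤ 2 * μ.real (S \ U) := by linarith
  have hne : μ (S \ U) ≠ ∞ := measure_ne_top_of_subset Set.sdiff_subset hμ
  rw [← ENNReal.toReal_le_toReal hμ (ENNReal.mul_ne_top ENNReal.ofNat_ne_top hne),
    ENNReal.toReal_mul]
  exact h3

/-- The bilinear form of the operator is dominated by the integral of the product of the scalar
maximal functions, with a constant that involves only one `L^p` bound of the operator.

The cubes inside a largest cube `S` are stopped where the lattice maximal function of `f` or `g`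
exceeds in norm a large multiple of the average of `‖f‖` or `‖g‖` over `S`.  The cubes that are not
stopped are controlled by the averages over `S`; the stopped ones cover at most half of `S` and are
treated by induction. -/
theorem DyadicOperatorBound.dyadicForm_le_lintegral [IsLocallyFiniteMeasure μ]
    {𝒟₀ : Finset (DyadicCube d)} {p : ℝ≥0∞} {A : ℝ≥0} (hT : DyadicOperatorBound 𝒟₀ l μ p A)
    (hp1 : 1 < p) (hp : p < ∞) (hl : ∀ Q ∈ 𝒟₀, ∀ c : C, 0 ≤ c → 0 ≤ l Q c) {W : ℝ} (hW : 0 < W)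
    (hC : LatticeWeakType C μ W) (hD : LatticeWeakType (LatticeDual D) μ W)
    {f : (Fin d → ℝ) → C} {g : (Fin d → ℝ) → LatticeDual D} (hf : ∀ y, 0 ≤ f y)
    (hfi : ∀ Q : DyadicCube d, IntegrableOn f Q.toSet μ)
    (hgi : ∀ Q : DyadicCube d, IntegrableOn g Q.toSet μ) (𝒟 : Finset (DyadicCube d))
    (h𝒟 : 𝒟 ⊆ 𝒟₀) :
    ENNReal.ofReal (dyadicForm 𝒟 l μ f g) ≤
      ENNReal.ofReal (32 * W ^ 2) * A * ∫⁻ y, maximalProduct 𝒟 μ f g y ∂μ := by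
  classical
  set K : ℝ≥0∞ := ENNReal.ofReal (32 * W ^ 2) * A with hK
  induction 𝒟 using Finset.strongInduction with
  | H 𝒟 ih =>
  rcases 𝒟.eq_empty_or_nonempty with rfl | hne
  · simp [dyadicForm]
  -- A splitting of `𝒟` splits the form, and the maximal functions if the supports are disjoint.
  have split : ∀ P : DyadicCube d → Prop, dyadicForm 𝒟 l μ f g =
      dyadicForm (𝒟.filter P) l μ f g + dyadicForm (𝒟.filter fun Q => ¬P Q) l μ f g := fun P =>
    (Finset.sum_filter_add_sum_filter_not 𝒟 P _).symm
  obtain ⟨S, hS, hmin⟩ := 𝒟.exists_min_image (fun Q => Q.k) hne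
  by_cases hall : ∀ Q ∈ 𝒟, Q.toSet ⊆ S.toSet
  swap
  · have h1 : 𝒟.filter (fun Q => Q.toSet ⊆ S.toSet) ⊂ 𝒟 := by
      rw [Finset.filter_ssubset]
      push Not at hall
      exact hall
    have h2 : (𝒟.filter fun Q => ¬Q.toSet ⊆ S.toSet) ⊂ 𝒟 := by
      rw [Finset.filter_ssubset]
      exact ⟨S, hS, not_not.2 subset_rfl⟩
    rw [split fun Q => Q.toSet ⊆ S.toSet]
    refine ENNReal.ofReal_add_le.trans ((add_le_add (ih _ h1 (h1.1.trans h𝒟))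
      (ih _ h2 (h2.1.trans h𝒟))).trans ?_)
    rw [← mul_add]
    gcongr
    refine (le_lintegral_add _ _).trans (lintegral_mono fun y => ?_)
    by_cases hy : y ∈ S.toSet
    · simp only
      rw [maximalProduct_eq_zero (𝒟 := 𝒟.filter fun Q => ¬Q.toSet ⊆ S.toSet), add_zero]
      · exact maximalProduct_mono h1.1 f g y
      · intro Q hQ hyQ
        rw [Finset.mem_filter] at hQ
        exact Set.disjoint_left.1
          ((DyadicCube.subset_or_disjoint (hmin Q hQ.1)).resolve_left hQ.2) hyQ hy
    · simp only
      rw [maximalProduct_eq_zero (𝒟 := 𝒟.filter fun Q => Q.toSet ⊆ S.toSet), zero_add]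
      · exact maximalProduct_mono h2.1 f g y
      · exact fun Q hQ hyQ => hy ((Finset.mem_filter.1 hQ).2 hyQ)
  have hSm := S.measurableSet_toSet
  have hSμ := (S.measure_toSet_lt_top μ).ne
  set F := ⨍ y in S.toSet, ‖f y‖ ∂μ with hF
  set G := ⨍ y in S.toSet, ‖g y‖ ∂μ with hG
  rcases (setAverage_norm_nonneg S.toSet f).eq_or_lt with hF0 | hF0
  · rw [dyadicForm_eq_zero hSμ (hfi S) (hgi S) hall (Or.inl hF0.symm)]
    simp
  rcases (setAverage_norm_nonneg S.toSet g).eq_or_lt with hG0 | hG0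
  · rw [dyadicForm_eq_zero hSμ (hfi S) (hgi S) hall (Or.inr hG0.symm)]
    simp
  have hS0 : 0 < μ.real S.toSet := by
    refine measureReal_nonneg.lt_of_ne fun h => ?_
    rw [setAverage_eq, ← h, inv_zero, zero_smul] at hF0
    exact lt_irrefl _ hF0
  -- With the factor `4 * W`, each of the two exceptional sets covers at most a quarter of `S`.
  set Ωf := {y | 4 * W * F < ‖cubeSup 𝒟 (fun Q => ⨍ z in Q.toSet, f z ∂μ) 0 y‖} with hΩf
  set Ωg := {y | 4 * W * G < ‖cubeSup 𝒟 (fun Q => ⨍ z in Q.toSet, g z ∂μ) 0 y‖} with hΩg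
  set Ω := Ωf ∪ Ωg
  have hΩ : μ.real (S.toSet ∩ Ω) ≤ μ.real S.toSet / 2 := by
    have h1 := hC.measureReal_le hW hSm hSμ (hfi S) hall hF0
    have h2 := hD.measureReal_le hW hSm hSμ (hgi S) hall hG0
    have h3 := measureReal_union_le (μ := μ) (S.toSet ∩ Ωf) (S.toSet ∩ Ωg)
    rw [← Set.inter_union_distrib_left] at h3
    have e1 : S.toSet ∩ Ωf = {y ∈ S.toSet | 4 * W * F <
      ‖cubeSup 𝒟 (fun Q => ⨍ z in Q.toSet, f z ∂μ) 0 y‖} := rfl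
    have e2 : S.toSet ∩ Ωg = {y ∈ S.toSet | 4 * W * G <
      ‖cubeSup 𝒟 (fun Q => ⨍ z in Q.toSet, g z ∂μ) 0 y‖} := rfl
    rw [e1, e2] at h3
    linarith
  set ℬ := 𝒟.filter fun Q => Q.toSet ⊆ Ω
  set 𝒢 := 𝒟.filter fun Q => ¬Q.toSet ⊆ Ω
  have hℬ : ℬ ⊂ 𝒟 := by
    rw [Finset.filter_ssubset]
    refine ⟨S, hS, fun h => ?_⟩
    rw [Set.inter_eq_left.2 h] at hΩ
    linarith
  have h𝒢 : 𝒢 ⊆ 𝒟 := Finset.filter_subset _ _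
  have hgood := hT.dyadicForm_le_average (g := g) (a := 4 * W * F) (b := 4 * W * G) (Ω := Ω)
    hp1 hp hl h𝒟 h𝒢 hSm hSμ (fun Q hQ => hall Q (h𝒢 hQ))
    (fun Q hQ => (Finset.mem_filter.1 hQ).2) hf (by positivity) (by positivity)
    (fun y hy => not_lt.1 fun h => hy (Or.inl h)) (fun y hy => not_lt.1 fun h => hy (Or.inr h))
  set U : Set (Fin d → ℝ) := ⋃ Q ∈ ℬ, Q.toSet
  have hU : MeasurableSet U := ℬ.measurableSet_biUnion fun Q _ => Q.measurableSet_toSet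
  -- At least half of `S` is not covered by the stopped cubes.
  have hhalf : μ S.toSet ≤ 2 * μ (S.toSet \ U) := by
    refine measure_le_two_mul_measure_diff hU hSμ (le_trans ?_ hΩ)
    exact measureReal_mono (Set.inter_subset_inter_right _ (Set.iUnion₂_subset fun Q hQ =>
      (Finset.mem_filter.1 hQ).2)) (measure_ne_top_of_subset Set.inter_subset_left hSμ)
  have hgood' : ENNReal.ofReal (dyadicForm 𝒢 l μ f g) ≤
      K * ∫⁻ y, (S.toSet \ U).indicator (fun _ => ENNReal.ofReal F * ENNReal.ofReal G) y ∂μ := by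
    rw [lintegral_indicator_const (hSm.diff hU)]
    refine hgood.trans ?_
    refine (mul_le_mul_right hhalf _).trans_eq ?_
    rw [hK, ENNReal.ofReal_mul (p := 4 * W) (q := F) (by positivity),
      ENNReal.ofReal_mul (p := 4 * W) (q := G) (by positivity),
      show 32 * W ^ 2 = (4 * W) * (4 * W) * 2 by ring,
      ENNReal.ofReal_mul (p := 4 * W * (4 * W)) (q := 2) (by positivity),
      ENNReal.ofReal_mul (p := 4 * W) (q := 4 * W) (by positivity), ENNReal.ofReal_ofNat]
    ring
  rw [split fun Q => Q.toSet ⊆ Ω]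
  refine ENNReal.ofReal_add_le.trans ((add_le_add (ih _ hℬ (hℬ.1.trans h𝒟)) hgood').trans ?_)
  rw [← mul_add]
  gcongr
  refine (le_lintegral_add _ _).trans (lintegral_mono fun y => ?_)
  by_cases hy : y ∈ S.toSet \ U
  · simp only [Set.indicator_of_mem hy]
    rw [maximalProduct_eq_zero (𝒟 := 𝒟.filter fun Q => Q.toSet ⊆ Ω), zero_add]
    · exact mul_le_mul'
        (ENNReal.ofReal_le_ofReal
          (apply_le_cubeSup (a := fun Q => ⨍ z in Q.toSet, ‖f z‖ ∂μ) hS hy.1))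
        (ENNReal.ofReal_le_ofReal
          (apply_le_cubeSup (a := fun Q => ⨍ z in Q.toSet, ‖g z‖ ∂μ) hS hy.1))
    · exact fun Q hQ hyQ => hy.2 (Set.mem_biUnion hQ hyQ)
  · simp only [Set.indicator_of_notMem hy, add_zero]
    exact maximalProduct_mono hℬ.1 f g y

end Sparse

/-! ### Duality and the extrapolation of the bound -/

theorem LatticeWeakType.mono {d : ℕ} {E : Type*} [NormedAddCommGroup E] [NormedSpace ℝ E]
    [Lattice E] {μ : Measure (Fin d → ℝ)} {V W : ℝ} (h : LatticeWeakType E μ V) (hVW : V ≤ W) :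
    LatticeWeakType E μ W := fun A f 𝒟 t ht hA hμ hf h𝒟 =>
  (h A f 𝒟 t ht hA hμ hf h𝒟).trans
    (mul_le_mul_of_nonneg_right hVW (integral_nonneg fun _ => norm_nonneg _))

theorem LatticeDual.exists_norming {E : Type*} [NormedAddCommGroup E] [NormedSpace ℝ E] (v : E) :
    ∃ φ : LatticeDual E, ‖φ‖ ≤ 1 ∧ φ v = ‖v‖ := by
  obtain ⟨φ, h1, h2⟩ := exists_dual_vector'' ℝ v
  exact ⟨LatticeDual.ofCLM φ, h1, h2⟩

section

variable {C D : Type*} [NormedAddCommGroup C] [NormedSpace ℝ C]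
  [NormedAddCommGroup D] [NormedSpace ℝ D] {d : ℕ} {μ : Measure (Fin d → ℝ)}

/-- `T_λ(f μ)` takes finitely many values, so that every function of it is measurable. -/
theorem exists_simpleFunc_eq_dyadicOperator (𝒟 : Finset (DyadicCube d))
    (l : DyadicCube d → C →ₗ[ℝ] D) (f : (Fin d → ℝ) → C) :
    ∃ s : SimpleFunc (Fin d → ℝ) D, ∀ y, s y = dyadicOperator 𝒟 l μ f y := by
  classical
  simp only [dyadicOperator]
  induction 𝒟 using Finset.induction_on with
  | empty => exact ⟨0, by simp⟩
  | insert Q 𝒟 hQ ih =>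
    obtain ⟨s, hs⟩ := ih
    refine ⟨SimpleFunc.piecewise Q.toSet Q.measurableSet_toSet
      (SimpleFunc.const _ (l Q (∫ y in Q.toSet, f y ∂μ))) 0 + s, fun y => ?_⟩
    rw [Finset.sum_insert hQ, ← hs]
    by_cases hy : y ∈ Q.toSet <;> simp [hy]

theorem memLp_dyadicOperator [IsLocallyFiniteMeasure μ] (𝒟 : Finset (DyadicCube d))
    (l : DyadicCube d → C →ₗ[ℝ] D) (f : (Fin d → ℝ) → C) (p : ℝ≥0∞) :
    MemLp (dyadicOperator 𝒟 l μ f) p μ :=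
  memLp_finsetSum _ fun Q _ => memLp_indicator_const p Q.measurableSet_toSet _
    (Or.inr (Q.measure_toSet_lt_top μ).ne)

theorem integrableOn_toSet_of_memLp {E : Type*} [NormedAddCommGroup E] [IsLocallyFiniteMeasure μ]
    {p : ℝ≥0∞} (hp : 1 ≤ p) {f : (Fin d → ℝ) → E} (hf : MemLp f p μ) (Q : DyadicCube d) :
    IntegrableOn f Q.toSet μ := by
  have : IsFiniteMeasure (μ.restrict Q.toSet) := ⟨by simpa using Q.measure_toSet_lt_top μ⟩
  exact (hf.restrict _).integrable hp

theorem ENNReal.rpow_le_of_le_mul_rpow {X a : ℝ≥0∞} {r s : ℝ} (h : r.HolderConjugate s)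
    (hX : X ≠ ∞) (hle : X ≤ a * X ^ (1 / s)) : X ^ (1 / r) ≤ a := by
  rcases eq_or_ne X 0 with rfl | h0
  · rw [ENNReal.zero_rpow_of_pos (one_div_pos.2 h.pos)]
    exact zero_le
  have e : X = X ^ (1 / r) * X ^ (1 / s) := by
    rw [← ENNReal.rpow_add _ _ h0 hX, one_div, one_div, h.inv_add_inv_eq_one, ENNReal.rpow_one]
  have h1 : X ^ (1 / s) ≠ 0 := by
    rw [Ne, ENNReal.rpow_eq_zero_iff]
    simp [h0, hX]
  have h2 : X ^ (1 / s) ≠ ∞ := ENNReal.rpow_ne_top_of_nonneg (one_div_nonneg.2 h.symm.nonneg) hX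
  rw [← ENNReal.mul_le_mul_iff_left h1 h2, ← e]
  exact hle

variable [Lattice C] [HasSolidNorm C] [IsOrderedAddMonoid C] [IsOrderedModule ℝ C]
  [Lattice D] [HasSolidNorm D] [IsOrderedAddMonoid D] {l : DyadicCube d → C →ₗ[ℝ] D}

theorem dyadicOperator_mono {C D : Type*} [NormedAddCommGroup C] [NormedSpace ℝ C] [Lattice C]
    [HasSolidNorm C] [IsOrderedAddMonoid C] [IsOrderedModule ℝ C] [NormedAddCommGroup D]
    [NormedSpace ℝ D] [Lattice D] [IsOrderedAddMonoid D] {l : DyadicCube d → C →ₗ[ℝ] D}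
    {𝒟 : Finset (DyadicCube d)}
    (hl : ∀ Q ∈ 𝒟, ∀ c : C, 0 ≤ c → 0 ≤ l Q c) {f g : (Fin d → ℝ) → C}
    (hf : ∀ Q : DyadicCube d, IntegrableOn f Q.toSet μ)
    (hg : ∀ Q : DyadicCube d, IntegrableOn g Q.toSet μ) (hfg : f ≤ g) (y : Fin d → ℝ) :
    dyadicOperator 𝒟 l μ f y ≤ dyadicOperator 𝒟 l μ g y :=
  Finset.sum_le_sum fun Q hQ => Set.indicator_le_indicator
    (LinearMap.apply_le_apply_of_nonneg (hl Q hQ) (integral_mono (hf Q) (hg Q) hfg))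

theorem norm_dyadicOperator_le_abs {𝒟 : Finset (DyadicCube d)}
    (hl : ∀ Q ∈ 𝒟, ∀ c : C, 0 ≤ c → 0 ≤ l Q c) {f : (Fin d → ℝ) → C}
    (hf : ∀ Q : DyadicCube d, IntegrableOn f Q.toSet μ)
    (hf' : ∀ Q : DyadicCube d, IntegrableOn (fun y => |f y|) Q.toSet μ) (y : Fin d → ℝ) :
    ‖dyadicOperator 𝒟 l μ f y‖ ≤ ‖dyadicOperator 𝒟 l μ (fun y => |f y|) y‖ := by
  have h1 := dyadicOperator_mono hl hf hf' (fun y => le_abs_self (f y)) y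
  have h2 := dyadicOperator_mono hl (fun Q => (hf Q).neg) hf' (fun y => neg_le_abs (f y)) y
  have e : dyadicOperator 𝒟 l μ (-f) y = -dyadicOperator 𝒟 l μ f y := by
    simp only [dyadicOperator, Pi.neg_apply, integral_neg, map_neg, ← Finset.sum_neg_distrib]
    refine Finset.sum_congr rfl fun Q _ => ?_
    by_cases hy : y ∈ Q.toSet <;> simp [hy]
  rw [e] at h2
  exact norm_le_norm_of_abs_le_abs ((abs_le'.2 ⟨h1, h2⟩).trans (le_abs_self _))

/-- The constant of the extrapolation in terms of the weak-type constant `W` and of the constants in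
Doob's inequality for the exponent `r` and its conjugate exponent `s`. -/
noncomputable def extrapolationConst (W r s : ℝ) : ℝ≥0∞ :=
  ENNReal.ofReal (32 * W ^ 2) * ENNReal.ofReal ((r / (r - 1)) ^ r) ^ (1 / r) *
    ENNReal.ofReal ((s / (s - 1)) ^ s) ^ (1 / s)

theorem extrapolationConst_ne_top (W : ℝ) {r s : ℝ} (h : r.HolderConjugate s) :
    extrapolationConst W r s ≠ ∞ :=
  ENNReal.mul_ne_top (ENNReal.mul_ne_top ENNReal.ofReal_ne_top
    (ENNReal.rpow_ne_top_of_nonneg (one_div_nonneg.2 h.nonneg) ENNReal.ofReal_ne_top))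
    (ENNReal.rpow_ne_top_of_nonneg (one_div_nonneg.2 h.symm.nonneg) ENNReal.ofReal_ne_top)

theorem lintegral_maximalProduct_le {E F : Type*} [NormedAddCommGroup E] [NormedAddCommGroup F]
    [IsLocallyFiniteMeasure μ] {r s : ℝ} (h : r.HolderConjugate s) {f : (Fin d → ℝ) → E}
    {g : (Fin d → ℝ) → F} (hf : MemLp f (ENNReal.ofReal r) μ) (hg : MemLp g (ENNReal.ofReal s) μ)
    (𝒟 : Finset (DyadicCube d)) :
    ∫⁻ y, maximalProduct 𝒟 μ f g y ∂μ ≤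
      (ENNReal.ofReal ((r / (r - 1)) ^ r) * ∫⁻ y, ‖f y‖ₑ ^ r ∂μ) ^ (1 / r) *
        (ENNReal.ofReal ((s / (s - 1)) ^ s) * ∫⁻ y, ‖g y‖ₑ ^ s ∂μ) ^ (1 / s) := by
  have hm : ∀ a : DyadicCube d → ℝ, AEMeasurable (fun y => ENNReal.ofReal (cubeSup 𝒟 a 0 y)) μ :=
    fun a => (stronglyMeasurable_cubeSup 𝒟 a 0).measurable.ennreal_ofReal.aemeasurable
  refine (ENNReal.lintegral_mul_le_Lp_mul_Lq μ h (hm _) (hm _)).trans ?_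
  have hr := one_div_nonneg.2 h.nonneg
  have hs := one_div_nonneg.2 h.symm.nonneg
  exact mul_le_mul' (ENNReal.rpow_le_rpow (lintegral_cubeSup_rpow_le h.lt hf 𝒟) hr)
    (ENNReal.rpow_le_rpow (lintegral_cubeSup_rpow_le h.symm.lt hg 𝒟) hs)

variable [CompleteSpace C]

/-- The extrapolated bound for positive functions: `‖F‖_r` for `F = T_λ(f μ)` is computed by testing
against `g = ‖F‖^(r-1) φ_F`, where the functional `φ_v` norms the vector `v`. -/
theorem DyadicOperatorBound.lintegral_rpow_le [IsLocallyFiniteMeasure μ]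
    {𝒟 : Finset (DyadicCube d)} {p : ℝ≥0∞} {A : ℝ≥0} (hT : DyadicOperatorBound 𝒟 l μ p A)
    (hp1 : 1 < p) (hp : p < ∞) (hl : ∀ Q ∈ 𝒟, ∀ c : C, 0 ≤ c → 0 ≤ l Q c) {W : ℝ} (hW : 0 < W)
    (hC : LatticeWeakType C μ W) (hD : LatticeWeakType (LatticeDual D) μ W)
    {r s : ℝ} (h : r.HolderConjugate s) {f : (Fin d → ℝ) → C} (hf : ∀ y, 0 ≤ f y)
    (hfr : MemLp f (ENNReal.ofReal r) μ) :
    (∫⁻ y, ‖dyadicOperator 𝒟 l μ f y‖ₑ ^ r ∂μ) ^ (1 / r) ≤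
      extrapolationConst W r s * A * (∫⁻ y, ‖f y‖ₑ ^ r ∂μ) ^ (1 / r) := by
  set F := dyadicOperator 𝒟 l μ f with hF
  have hr0 : 0 < r := h.pos
  have hr1 : 0 < r - 1 := h.sub_one_pos
  have hr : ENNReal.ofReal r ≠ 0 := by simpa using hr0
  have hs : ENNReal.ofReal s ≠ 0 := by simpa using h.symm.pos
  have hFr : MemLp F (ENNReal.ofReal r) μ := memLp_dyadicOperator 𝒟 l f _
  have hX : ∫⁻ y, ‖F y‖ₑ ^ r ∂μ ≠ ∞ := by
    have := (eLpNorm_lt_top_iff_lintegral_rpow_enorm_lt_top hr ENNReal.ofReal_ne_top).1 hFr.2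
    rw [ENNReal.toReal_ofReal hr0.le] at this
    exact this.ne
  obtain ⟨σ, hσ⟩ := exists_simpleFunc_eq_dyadicOperator (μ := μ) 𝒟 l f
  -- The functionals are chosen without any regularity; `g` is measurable since `F` is simple.
  choose φ hφ1 hφ2 using fun v : D => LatticeDual.exists_norming v
  set g : (Fin d → ℝ) → LatticeDual D := fun y => ‖F y‖ ^ (r - 1) • φ (F y) with hg
  have hgm : StronglyMeasurable g := by
    have := (σ.map fun v => ‖v‖ ^ (r - 1) • φ v).stronglyMeasurable
    rwa [show ⇑(σ.map fun v => ‖v‖ ^ (r - 1) • φ v) = g from funext fun y => by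
      simp only [SimpleFunc.map_apply, hσ, hg, hF]] at this
  have hgn : ∀ y, ‖g y‖ₑ ^ s ≤ ‖F y‖ₑ ^ r := fun y => by
    have h1 : ‖g y‖ ≤ ‖F y‖ ^ (r - 1) := by
      rw [hg, norm_smul, Real.norm_of_nonneg (by positivity)]
      exact mul_le_of_le_one_right (by positivity) (hφ1 _)
    calc ‖g y‖ₑ ^ s ≤ (‖F y‖ₑ ^ (r - 1)) ^ s := by
          refine ENNReal.rpow_le_rpow ?_ h.symm.nonneg
          rw [← ofReal_norm_rpow _ hr1.le, ← ofReal_norm]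
          exact ENNReal.ofReal_le_ofReal h1
      _ = _ := by rw [← ENNReal.rpow_mul, h.sub_one_mul_conj]
  have hgX : ∫⁻ y, ‖g y‖ₑ ^ s ∂μ ≤ ∫⁻ y, ‖F y‖ₑ ^ r ∂μ := lintegral_mono hgn
  have hgs : MemLp g (ENNReal.ofReal s) μ := by
    refine ⟨hgm.aestronglyMeasurable, ?_⟩
    rw [eLpNorm_lt_top_iff_lintegral_rpow_enorm_lt_top hs ENNReal.ofReal_ne_top,
      ENNReal.toReal_ofReal h.symm.nonneg]
    exact hgX.trans_lt hX.lt_top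
  have one_le : ∀ {t : ℝ}, 1 < t → 1 ≤ ENNReal.ofReal t := fun ht => by
    rw [← ENNReal.ofReal_one]
    exact ENNReal.ofReal_le_ofReal ht.le
  have hfi := integrableOn_toSet_of_memLp (one_le h.lt) hfr
  have hgi := integrableOn_toSet_of_memLp (one_le h.symm.lt) hgs
  have hgF : ∀ y, g y (F y) = ‖F y‖ ^ r := fun y => by
    have e : ‖F y‖ ^ (r - 1) * ‖F y‖ = ‖F y‖ ^ r := by
      rw [← Real.rpow_add_one' (norm_nonneg _) (by linarith)]
      simp
    exact (LatticeDual.smul_apply (‖F y‖ ^ (r - 1)) (φ (F y)) (F y)).trans (by rw [hφ2, e])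
  have hform : ∫⁻ y, ‖F y‖ₑ ^ r ∂μ = ENNReal.ofReal (dyadicForm 𝒟 l μ f g) := by
    rw [dyadicForm_eq_integral l f fun Q _ => hgi Q]
    simp only [← hF, hgF]
    have hi : Integrable (fun y => ‖F y‖ ^ r) μ := by
      have := hFr.integrable_norm_rpow hr ENNReal.ofReal_ne_top
      rwa [ENNReal.toReal_ofReal hr0.le] at this
    rw [ofReal_integral_eq_lintegral_ofReal hi (Filter.Eventually.of_forall fun y => by positivity)]
    simp only [ofReal_norm_rpow _ hr0.le]
  refine ENNReal.rpow_le_of_le_mul_rpow h hX ?_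
  calc ∫⁻ y, ‖F y‖ₑ ^ r ∂μ
      ≤ ENNReal.ofReal (32 * W ^ 2) * A * ∫⁻ y, maximalProduct 𝒟 μ f g y ∂μ :=
        hform.trans_le (hT.dyadicForm_le_lintegral hp1 hp hl hW hC hD hf hfi hgi 𝒟 subset_rfl)
    _ ≤ ENNReal.ofReal (32 * W ^ 2) * A *
          ((ENNReal.ofReal ((r / (r - 1)) ^ r) * ∫⁻ y, ‖f y‖ₑ ^ r ∂μ) ^ (1 / r) *
            (ENNReal.ofReal ((s / (s - 1)) ^ s) * ∫⁻ y, ‖F y‖ₑ ^ r ∂μ) ^ (1 / s)) := by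
        refine mul_le_mul_right ((lintegral_maximalProduct_le h hfr hgs 𝒟).trans ?_) _
        exact mul_le_mul_right (ENNReal.rpow_le_rpow (mul_le_mul_right hgX _)
          (one_div_nonneg.2 h.symm.nonneg)) _
    _ = _ := by
        rw [ENNReal.mul_rpow_of_nonneg _ _ (one_div_nonneg.2 h.nonneg),
          ENNReal.mul_rpow_of_nonneg _ _ (one_div_nonneg.2 h.symm.nonneg), extrapolationConst]
        ring

/-- A bound of the positive dyadic operator on one `L^p` implies a bound on every `L^q`. -/
theorem DyadicOperatorBound.extrapolate [IsLocallyFiniteMeasure μ]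
    {𝒟 : Finset (DyadicCube d)} {p q : ℝ≥0∞} {A : ℝ≥0} (hT : DyadicOperatorBound 𝒟 l μ p A)
    (hp1 : 1 < p) (hp : p < ∞) (hl : ∀ Q ∈ 𝒟, ∀ c : C, 0 ≤ c → 0 ≤ l Q c) {W : ℝ} (hW : 0 < W)
    (hC : LatticeWeakType C μ W) (hD : LatticeWeakType (LatticeDual D) μ W)
    (hq : q < ∞) {s : ℝ} (h : q.toReal.HolderConjugate s) :
    DyadicOperatorBound 𝒟 l μ q ((extrapolationConst W q.toReal s).toNNReal * A) := by
  intro f hf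
  have hq1 : 1 ≤ q := by
    rw [← ENNReal.ofReal_toReal hq.ne, ← ENNReal.ofReal_one]
    exact ENNReal.ofReal_le_ofReal h.lt.le
  have hq0 : q ≠ 0 := (zero_lt_one.trans_le hq1).ne'
  have hf' : MemLp (fun y => |f y|) q μ :=
    hf.congr_norm (hf.1.sup hf.1.neg) (Filter.Eventually.of_forall fun y =>
      (norm_abs_eq_norm (f y)).symm)
  have hmain := hT.lintegral_rpow_le hp1 hp hl hW hC hD h (fun y => abs_nonneg (f y))
    (by rwa [ENNReal.ofReal_toReal hq.ne])
  rw [ENNReal.coe_mul, ENNReal.coe_toNNReal (extrapolationConst_ne_top W h)]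
  refine (eLpNorm_mono (norm_dyadicOperator_le_abs hl (integrableOn_toSet_of_memLp hq1 hf)
    (integrableOn_toSet_of_memLp hq1 hf'))).trans ?_
  rw [eLpNorm_eq_lintegral_rpow_enorm_toReal hq0 hq.ne,
    eLpNorm_eq_lintegral_rpow_enorm_toReal hq0 hq.ne]
  refine hmain.trans_eq ?_
  simp only [← ofReal_norm, norm_abs_eq_norm]

end

theorem mainTheorem4 {C D : Type*}
    [NormedAddCommGroup C] [NormedSpace ℝ C] [CompleteSpace C] [Lattice C] [HasSolidNorm C]
    [IsOrderedAddMonoid C] [IsOrderedModule ℝ C]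
    [NormedAddCommGroup D] [NormedSpace ℝ D] [CompleteSpace D] [Lattice D] [HasSolidNorm D]
    [IsOrderedAddMonoid D] [IsOrderedModule ℝ D]
    {d : ℕ} (hd : 0 < d)
    (hC : HasHardyLittlewoodProperty d C) (hD : HasHardyLittlewoodProperty d (LatticeDual D)) :
    (∀ (μ : Measure (Fin d → ℝ)) [IsLocallyFiniteMeasure μ] (𝒮 : Set (DyadicCube d))
        (l : DyadicCube d → C →ₗ[ℝ] D), (∀ Q ∈ 𝒮, ∀ c : C, 0 ≤ c → 0 ≤ l Q c) →
        ((∃ p : ℝ≥0∞, 1 < p ∧ p < ∞ ∧ DyadicOperatorBounded 𝒮 l μ p) ↔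
          ∀ p : ℝ≥0∞, 1 < p → p < ∞ → DyadicOperatorBounded 𝒮 l μ p)) ∧
    (∀ q : ℝ≥0∞, 1 < q → q < ∞ → ∃ K : ℝ≥0,
      ∀ (μ : Measure (Fin d → ℝ)) [IsLocallyFiniteMeasure μ] (𝒟 : Finset (DyadicCube d))
        (l : DyadicCube d → C →ₗ[ℝ] D), (∀ Q ∈ 𝒟, ∀ c : C, 0 ≤ c → 0 ≤ l Q c) →
        ∀ p : ℝ≥0∞, 1 < p → p < ∞ → ∀ A : ℝ≥0,
          DyadicOperatorBound 𝒟 l μ p A → DyadicOperatorBound 𝒟 l μ q (K * A)) := by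
  obtain ⟨V, hV1, hV⟩ := hC.exists_weakType hd
  obtain ⟨W, _, hW⟩ := hD.exists_weakType hd
  have hpos : 0 < max V W := lt_max_of_lt_left (by linarith)
  have hquant : ∀ q : ℝ≥0∞, 1 < q → q < ∞ → ∃ K : ℝ≥0,
      ∀ (μ : Measure (Fin d → ℝ)) [IsLocallyFiniteMeasure μ] (𝒟 : Finset (DyadicCube d))
        (l : DyadicCube d → C →ₗ[ℝ] D), (∀ Q ∈ 𝒟, ∀ c : C, 0 ≤ c → 0 ≤ l Q c) →
        ∀ p : ℝ≥0∞, 1 < p → p < ∞ → ∀ A : ℝ≥0,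
          DyadicOperatorBound 𝒟 l μ p A → DyadicOperatorBound 𝒟 l μ q (K * A) := by
    intro q hq1 hq
    have hr : 1 < q.toReal := by
      rw [← ENNReal.toReal_one]
      exact (ENNReal.toReal_lt_toReal ENNReal.one_ne_top hq.ne).2 hq1
    exact ⟨_, fun μ _ 𝒟 l hl p hp1 hp A hT => hT.extrapolate hp1 hp hl hpos
      ((hV μ).mono (le_max_left V W)) ((hW μ).mono (le_max_right V W)) hq
      (Real.HolderConjugate.conjExponent hr)⟩
  refine ⟨fun μ _ 𝒮 l hl => ⟨?_, fun h => ⟨2, by norm_num, by norm_num, h 2 (by norm_num)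
    (by norm_num)⟩⟩, hquant⟩
  rintro ⟨p, hp1, hp, A, hA⟩ q hq1 hq
  obtain ⟨K, hK⟩ := hquant q hq1 hq
  exact ⟨K * A, fun 𝒟 h𝒟 => hK μ 𝒟 l (fun Q hQ => hl Q (h𝒟 hQ)) p hp1 hp A (hA 𝒟 h𝒟)⟩
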